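/- For $x>0$ and $\tau\in\mathbb R$ let $K_{i\tau}(x)=\int_0^\infty e^{-x\cosh u}\cos(\tau u)\,du$ be the modified Bessel (Macdonald) function of imaginary index, let $L_n^\alpha(x)=\sum_{k=0}^n(-1)^k\binom{n+\alpha}{n-k}\frac{x^k}{k!}$ be the associated Laguerre polynomials, and for $\alpha,\beta>-1$, $\mu\ge 0$, $\eta>0$, $n\in\mathbb N_0$ put $$F_n(\tau;\alpha,\beta,\mu,\eta)=\int_0^\infty x^\beta e^{-\mu x}L_n^\alpha(x)K_{i\tau}(\eta x)\,dx .$$ Let $(z)_k=z(z+1)\cdots(z+k-1)$ be the Pochhammer symbol, ${}_3F_2(a_1,a_2,a_3;b_1,b_2;z)=\sum_{k\ge0}\frac{(a_1)_k(a_2)_k(a_3)_k}{(b_1)_k(b_2)_k}\frac{z^k}{k!}$, and let $$S_n(t^2;a,b,c)=(a+b)_n(a+c)_n\,{}_3F_2(-n,a+it,a-it;a+b,a+c;1)$$ be the continuous dual Hahn polynomials. The integrals defining $F_n$ converge absolutely, and the following hold. 1. If $\beta,\gamma>-1$, $\alpha=\beta+\gamma+1$ and $0<\mu\le1$, then for all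 $n,m\in\mathbb N_0$, with an absolutely convergent integral, $$\int_0^\infty\tau\sinh(\pi\tau)\,F_n(\tau;\alpha,\beta,\mu,\mu)\,F_m(\tau;\alpha,\gamma,1-\mu,\mu)\,d\tau=\frac{\pi^2}{2\,n!}\,\Gamma(n+\alpha+1)\,\delta_{n,m}.$$ 2. If $\alpha,\beta>-1$ and $\mu>0$, then for all $n\in\mathbb N_0$ and $\tau\in\mathbb R$, $$F_n(\tau;\alpha,\beta,\mu,\mu)=\frac{\sqrt\pi}{(2\mu)^{\beta+1}}\sum_{k=0}^n\frac{(-1)^k}{k!}\binom{n+\alpha}{n-k}(2\mu)^{-k}\,\frac{\Gamma(\beta+k+1-i\tau)\Gamma(\beta+k+1+i\tau)}{\Gamma(\beta+k+3/2)}$$ $$=\frac{\sqrt\pi}{(2\mu)^{\beta+1}\,n!}\,\frac{|\Gamma(\beta+1-i\tau)|^2(\alpha+1)_n}{\Gamma(\beta+3/2)}\;{}_3F_2\!\left(-n,\beta+1+i\tau,\beta+1-i\tau;\alpha+1,\beta+\tfrac32;\tfrac1{2\mu}\right),$$ where the ${}_3F_2$ is, as a function of $\tau$, a polynomial with real coefficients.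 3. If $\beta,\gamma>-1$, then for all $n,m\in\mathbb N_0$, with an absolutely convergent integral, $$\int_0^\infty\left|\frac{\Gamma(\beta+1+it)\Gamma(\gamma+1+it)}{\Gamma(it)}\right|^2S_n\!\left(t^2;\beta+1,\gamma+1,\tfrac12\right)S_m\!\left(t^2;\beta+1,\gamma+1,\tfrac12\right)dt$$ $$=\frac{n!}{2}\,\delta_{n,m}\,\Gamma(n+\beta+\gamma+2)\,\Gamma\!\left(n+\beta+\tfrac32\right)\Gamma\!\left(n+\gamma+\tfrac32\right).$$ -/

import Mathlib

open MeasureTheory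

noncomputable section

/-- The modified Bessel (Macdonald) function `K_{iτ}(x)` of imaginary index `iτ`, for `x > 0`:
`K_{iτ}(x) = ∫_0^∞ exp(-x cosh u) cos(τ u) du`. It is real valued. -/
def macdonaldK (τ x : ℝ) : ℝ :=
  ∫ u in Set.Ioi (0 : ℝ), Real.exp (-x * Real.cosh u) * Real.cos (τ * u)

/-- The associated Laguerre polynomial
`L_n^α(x) = ∑_{k=0}^n (-1)^k binom(n+α, n-k) x^k / k!`, with the generalized binomial
coefficient. -/
def laguerreL (n : ℕ) (α x : ℝ) : ℝ :=
  ∑ k ∈ Finset.range (n + 1),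
    (-1 : ℝ) ^ k * Ring.choose ((n : ℝ) + α) (n - k) * (x ^ k / (k.factorial : ℝ))

/-- The integrand `x^β e^{-μx} L_n^α(x) K_{iτ}(ηx)`. -/
def klLaguerreIntegrand (n : ℕ) (τ α β μ η x : ℝ) : ℝ :=
  x ^ β * Real.exp (-μ * x) * laguerreL n α x * macdonaldK τ (η * x)

/-- The Kontorovich-Lebedev integral
`F_n(τ; α, β, μ, η) = ∫_0^∞ x^β e^{-μx} L_n^α(x) K_{iτ}(ηx) dx`. -/
def klLaguerre (n : ℕ) (τ α β μ η : ℝ) : ℝ :=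
  ∫ x in Set.Ioi (0 : ℝ), klLaguerreIntegrand n τ α β μ η x

/-- The Pochhammer symbol `(z)_k = z (z+1) ⋯ (z+k-1)`. -/
def poch (z : ℂ) (k : ℕ) : ℂ := (ascPochhammer ℂ k).eval z

/-- The generalized hypergeometric series `₃F₂(a₁, a₂, a₃; b₁, b₂; z)`. -/
def hyp3F2 (a₁ a₂ a₃ b₁ b₂ z : ℂ) : ℂ :=
  ∑' k : ℕ, poch a₁ k * poch a₂ k * poch a₃ k / (poch b₁ k * poch b₂ k) *
    (z ^ k / (k.factorial : ℂ))

/-- The continuous dual Hahn polynomial at `t²`: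
`S_n(t²; a, b, c) = (a+b)_n (a+c)_n ₃F₂(-n, a+it, a-it; a+b, a+c; 1)`. -/
def dualHahnS (n : ℕ) (t a b c : ℝ) : ℂ :=
  poch (a + b) n * poch (a + c) n *
    hyp3F2 (-(n : ℂ)) (a + Complex.I * t) (a - Complex.I * t) (a + b) (a + c) 1

end

/-! Up to a constant, the Kontorovich-Lebedev transform of `x^(a-1) e^(-x)` is `|Γ(a+iτ)|²`
(`integral_rpow_mul_exp_neg_mul_macdonaldK`). Indeed `K_{iτ}(x)` is half the Fourier transform of
`e^(-x cosh u)`; integrating over `x` leaves the Fourier transform of `(1 + cosh u)^(-a)`, which is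
a beta integral. Expanding `L_n^α` in powers of `x` and rescaling by `μ` gives the explicit sum, and
the `₃F₂` form follows from `Γ(z+k) = Γ(z) (z)_k` (`klLaguerre_self`, `klLaguerre_self_eq_hypPoly`).

The orthogonality over `τ` rests on a single case of the inversion formula
(`ae_integral_mul_macdonaldK_eq`): integrating `K_{iτ}(x) τ sinh(πτ) |Γ(a+iτ)|²` over `τ > 0`
returns a multiple of `x^a e^(-x)`. Both sides are compared through their Laplace transforms at `p =
cosh s`. There the transform of `K_{iτ}` is `π sin(sτ) / (sinh(πτ) sinh s)`, so the factor
`sinh(πτ)` cancels, and what remains is the sine transform of `τ |Γ(a+iτ)|²`, known from Fourier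
inversion of the beta integral. Fubini then evaluates each pair of monomials
(`integral_gammaSq_mul_integral_macdonaldK`). With `p = (1-μ)/μ` and `α = β+γ+1` all powers of `μ`
cancel, leaving the double sum of Laguerre coefficients against `Γ(α+1+k+j)`. This is Laguerre
orthogonality, proved by finite differences (`sum_sum_laguerreCoeff_mul_gamma`).

For `μ = 1/2` both transforms are of the explicit kind and are multiples of `|Γ|² S_n`. The
orthogonality becomes a biorthogonality between `S_n(·; β+1, γ+1, 1/2)` and `S_m(·; γ+1, β+1, 1/2)`
(`integral_dualHahnWeight_mul_mixed`). Both families have leading coefficient `(-1)^n` in `t²`, so a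
triangularity argument turns this into orthogonality of one family, without the symmetry of `S_n` in
its parameters. -/

/-! ### Elementary bounds for `cosh` and `exp` -/

lemma exp_abs_div_two_le_cosh (u : ℝ) : Real.exp |u| / 2 ≤ Real.cosh u := by
  rw [← Real.cosh_abs, Real.cosh_eq]
  have := Real.exp_pos (-|u|)
  linarith

lemma integrable_exp_neg_mul_abs {c : ℝ} (hc : 0 < c) :
    Integrable (fun u : ℝ => Real.exp (-(c * |u|))) := by
  rw [← integrableOn_univ, ← Set.Iic_union_Ioi (a := (0 : ℝ)), integrableOn_union]
  constructor
  · refine (integrableOn_exp_mul_Iic hc 0).congr_fun (fun u hu => ?_) measurableSet_Iic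
    simp only [Set.mem_Iic] at hu
    simp [abs_of_nonpos hu]
  · refine (integrableOn_exp_mul_Ioi (neg_lt_zero.mpr hc) 0).congr_fun (fun u hu => ?_)
      measurableSet_Ioi
    simp only [Set.mem_Ioi] at hu
    simp [abs_of_pos hu]

lemma cosh_rpow_neg_le {ε : ℝ} (hε : 0 ≤ ε) (u : ℝ) :
    Real.cosh u ^ (-ε) ≤ 2 ^ ε * Real.exp (-(ε * |u|)) := by
  calc Real.cosh u ^ (-ε) ≤ (Real.exp |u| / 2) ^ (-ε) :=
        Real.rpow_le_rpow_of_nonpos (by positivity) (exp_abs_div_two_le_cosh u) (by linarith)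
    _ = _ := by
        rw [Real.div_rpow (by positivity) (by norm_num), ← Real.exp_mul, Real.rpow_neg (by norm_num),
          div_inv_eq_mul, mul_comm]
        congr 2
        ring

lemma integrable_cosh_rpow_neg {ε : ℝ} (hε : 0 < ε) :
    Integrable (fun u : ℝ => Real.cosh u ^ (-ε)) := by
  refine ((integrable_exp_neg_mul_abs hε).const_mul (2 ^ ε)).mono' ?_ ?_
  · exact (Real.continuous_cosh.rpow_const
      (fun u => Or.inl (Real.cosh_pos u).ne')).aestronglyMeasurable
  · filter_upwards with u
    rw [Real.norm_of_nonneg (Real.rpow_nonneg (Real.cosh_pos u).le _)]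
    exact cosh_rpow_neg_le hε.le u

/-- Raise `z/ε ≤ e^(z/ε)` to the power `ε`. This trades exponential decay for an arbitrary power,
which is what makes the later majorants separate into products. -/
lemma exp_neg_le_rpow_neg {ε z : ℝ} (hε : 0 < ε) (hz : 0 < z) :
    Real.exp (-z) ≤ ε ^ ε * z ^ (-ε) := by
  have h1 : z / ε ≤ Real.exp (z / ε) := by
    have := Real.add_one_le_exp (z / ε); linarith
  have h2 : (z / ε) ^ ε ≤ Real.exp z := by
    calc (z / ε) ^ ε ≤ Real.exp (z / ε) ^ ε := Real.rpow_le_rpow (by positivity) h1 hε.le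
      _ = Real.exp z := by rw [← Real.exp_mul]; congr 1; field_simp
  rw [Real.div_rpow hz.le hε.le, div_le_iff₀ (by positivity)] at h2
  rw [Real.exp_neg, Real.rpow_neg hz.le, ← div_eq_mul_inv, inv_eq_one_div,
    div_le_div_iff₀ (by positivity) (by positivity)]
  linarith

/-! ### The function `|Γ(a+iτ)|²`: decay, recurrence and reflection -/

/-- `|Γ(a + iτ)|²`. -/
noncomputable def gammaSq (a τ : ℝ) : ℝ := ‖Complex.Gamma (a + Complex.I * τ)‖ ^ 2

lemma gammaSq_nonneg (a τ : ℝ) : 0 ≤ gammaSq a τ := by unfold gammaSq; positivity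

lemma gamma_sub_I_mul (a τ : ℝ) : Complex.Gamma (a - Complex.I * τ) =
    (starRingEnd ℂ) (Complex.Gamma (a + Complex.I * τ)) := by
  rw [← Complex.Gamma_conj]; congr 1; simp [sub_eq_add_neg]

lemma gamma_mul_gamma_eq_gammaSq (a τ : ℝ) :
    Complex.Gamma (a + Complex.I * τ) * Complex.Gamma (a - Complex.I * τ) = gammaSq a τ := by
  rw [gamma_sub_I_mul, Complex.mul_conj, gammaSq, Complex.normSq_eq_norm_sq]

lemma norm_gamma_sub_sq (a τ : ℝ) : ‖Complex.Gamma (a - Complex.I * τ)‖ ^ 2 = gammaSq a τ := by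
  rw [gamma_sub_I_mul, gammaSq, RCLike.norm_conj]

lemma gammaSq_neg (a τ : ℝ) : gammaSq a (-τ) = gammaSq a τ := by
  rw [← norm_gamma_sub_sq a τ, gammaSq]; congr 3; simp [sub_eq_add_neg]

lemma continuous_gammaSq {a : ℝ} (ha : 0 < a) : Continuous (gammaSq a) := by
  unfold gammaSq
  refine (Continuous.norm ?_).pow 2
  rw [continuous_iff_continuousAt]
  intro τ
  refine ContinuousAt.comp (f := fun τ : ℝ => (a : ℂ) + Complex.I * τ) (g := Complex.Gamma)
    (Complex.differentiableAt_Gamma _ fun m h => ?_).continuousAt (by fun_prop)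
  have := congrArg Complex.re h
  simp at this
  have : (0 : ℝ) ≤ m := m.cast_nonneg
  linarith

/-- The derivative in `y` of the integral over the line of height `y` is `i` times the integral of
`f'` along that line. This vanishes because `f'` is there the `u`-derivative of an integrable
function. The fundamental theorem of calculus in `y` and Fubini make this precise. -/
lemma integral_horizontal_shift {f f' : ℂ → ℂ} {θ : ℝ} {B : ℝ → ℝ} (hθ : 0 ≤ θ)
    (hf : ∀ z, HasDerivAt f (f' z) z) (hf' : Continuous f') (hB : Integrable B)
    (hfB : ∀ u : ℝ, ∀ y ∈ Set.Icc 0 θ, ‖f (u + y * Complex.I)‖ ≤ B u)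
    (hfB' : ∀ u : ℝ, ∀ y ∈ Set.Icc 0 θ, ‖f' (u + y * Complex.I)‖ ≤ B u) :
    ∫ u : ℝ, f (u + θ * Complex.I) = ∫ u : ℝ, f u := by
  have hcont : Continuous f := continuous_iff_continuousAt.mpr fun z => (hf z).continuousAt
  have hint : ∀ y ∈ Set.Icc 0 θ, Integrable fun u : ℝ => f (u + y * Complex.I) := fun y hy =>
    hB.mono' (Continuous.aestronglyMeasurable (by fun_prop))
      (Filter.Eventually.of_forall fun u => hfB u y hy)
  have hint' : ∀ y ∈ Set.Icc 0 θ, Integrable fun u : ℝ => f' (u + y * Complex.I) := fun y hy =>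
    hB.mono' (Continuous.aestronglyMeasurable (by fun_prop))
      (Filter.Eventually.of_forall fun u => hfB' u y hy)
  have hzero : ∀ y ∈ Set.Icc 0 θ, ∫ u : ℝ, f' (u + y * Complex.I) = 0 := fun y hy => by
    refine integral_eq_zero_of_hasDerivAt_of_integrable (f := fun u : ℝ => f (u + y * Complex.I))
      (fun u => ?_) (hint' y hy) (hint y hy)
    have h1 : HasDerivAt (fun z : ℂ => f (z + y * Complex.I)) (f' (u + y * Complex.I)) (u : ℂ) := by
      simpa using (hf (u + y * Complex.I)).comp_add_const (u : ℂ) (y * Complex.I)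
    exact h1.comp_ofReal
  have hftc : ∀ u : ℝ, ∫ y in (0 : ℝ)..θ, f' (u + y * Complex.I) * Complex.I =
      f (u + θ * Complex.I) - f u := fun u => by
    have := intervalIntegral.integral_eq_sub_of_hasDerivAt (a := 0) (b := θ)
      (f := fun y : ℝ => f (u + y * Complex.I)) (f' := fun y => f' (u + y * Complex.I) * Complex.I)
      (fun y _ => ?_) (Continuous.intervalIntegrable (by fun_prop) _ _)
    · simpa using this
    · have h1 : HasDerivAt (fun z : ℂ => (u : ℂ) + z * Complex.I) Complex.I (y : ℂ) := by
        simpa using ((hasDerivAt_id (y : ℂ)).mul_const Complex.I).const_add (u : ℂ)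
      exact ((hf (u + y * Complex.I)).comp (y : ℂ) h1).comp_ofReal
  have hswap : ∫ u : ℝ, ∫ y in (0 : ℝ)..θ, f' (u + y * Complex.I) * Complex.I = 0 := by
    simp_rw [intervalIntegral.integral_of_le hθ]
    rw [integral_integral_swap]
    · refine (setIntegral_congr_fun measurableSet_Ioc fun y hy => ?_).trans (integral_zero _ _)
      rw [integral_mul_const, hzero y ⟨hy.1.le, hy.2⟩, zero_mul]
    · have hBp : Integrable (fun p : ℝ × ℝ => B p.1 * (1 : ℝ))
          (volume.prod (volume.restrict (Set.Ioc 0 θ))) := hB.mul_prod (integrable_const 1)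
      refine hBp.mono' (Continuous.aestronglyMeasurable (by fun_prop)) ?_
      have : ∀ᵐ p : ℝ × ℝ ∂(volume.prod (volume.restrict (Set.Ioc 0 θ))), p.2 ∈ Set.Ioc 0 θ := by
        rw [Measure.ae_prod_iff_ae_ae (measurableSet_Ioc.preimage measurable_snd)]
        exact Filter.Eventually.of_forall fun _ => ae_restrict_mem measurableSet_Ioc
      filter_upwards [this] with p hp
      simpa [Function.uncurry] using hfB' p.1 p.2 ⟨hp.1.le, hp.2⟩
  simp_rw [hftc] at hswap
  rw [integral_sub (hint θ ⟨hθ, le_rfl⟩) (by simpa using hint 0 ⟨le_rfl, hθ⟩)] at hswap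
  exact sub_eq_zero.mp hswap

lemma integrable_exp_mul_sub_exp {a c : ℝ} (ha : 0 < a) (hc : 0 < c) :
    Integrable fun u : ℝ => Real.exp (a * u - c * Real.exp u) := by
  -- For `u ≤ 0` the double exponential is bounded by 1. For `u ≥ 0` the power bound with exponent
  -- `2a` turns `e^(au)` into a multiple of `e^(-au)`.
  set C := max 1 ((2 * a) ^ (2 * a) * c ^ (-(2 * a)))
  refine ((integrable_exp_neg_mul_abs ha).const_mul C).mono'
    (Continuous.aestronglyMeasurable (by fun_prop)) (Filter.Eventually.of_forall fun u => ?_)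
  rw [Real.norm_of_nonneg (Real.exp_pos _).le, sub_eq_add_neg, Real.exp_add]
  rcases le_total u 0 with hu | hu
  · have h1 : Real.exp (-(c * Real.exp u)) ≤ 1 := Real.exp_le_one_iff.mpr (by
      have := Real.exp_pos u; nlinarith)
    rw [abs_of_nonpos hu, mul_comm]
    simp only [mul_neg, neg_neg]
    gcongr
    exact h1.trans (le_max_left _ _)
  · have h1 := exp_neg_le_rpow_neg (ε := 2 * a) (z := c * Real.exp u) (by positivity) (by positivity)
    rw [Real.mul_rpow hc.le (Real.exp_pos _).le, ← Real.exp_mul] at h1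
    rw [abs_of_nonneg hu]
    calc _ ≤ Real.exp (a * u) * ((2 * a) ^ (2 * a) * (c ^ (-(2 * a)) * Real.exp (u * -(2 * a)))) := by
          gcongr
      _ = ((2 * a) ^ (2 * a) * c ^ (-(2 * a))) * Real.exp (-(a * u)) := by
          rw [show -(a * u) = a * u + u * -(2 * a) by ring, Real.exp_add]; ring
      _ ≤ _ := by gcongr; exact le_max_right _ _

lemma gamma_eq_integral_exp {s : ℂ} (hs : 0 < s.re) :
    Complex.Gamma s = ∫ u : ℝ, Complex.exp (s * u - Complex.exp u) := by
  rw [Complex.Gamma_eq_integral hs, Complex.GammaIntegral, ← Real.range_exp, ← Set.image_univ,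
    integral_image_eq_integral_abs_deriv_smul MeasurableSet.univ
      (fun x _ => (Real.hasDerivAt_exp x).hasDerivWithinAt) Real.exp_injective.injOn, setIntegral_univ]
  refine integral_congr_ae (Filter.Eventually.of_forall fun u => ?_)
  simp only [Complex.real_smul, abs_of_pos (Real.exp_pos u)]
  rw [Complex.cpow_def_of_ne_zero (by exact_mod_cast (Real.exp_pos u).ne'), ← Complex.ofReal_log
    (Real.exp_pos u).le, Real.log_exp, Complex.ofReal_exp, Complex.ofReal_exp,
    ← Complex.exp_add, ← Complex.exp_add]
  congr 1
  push_cast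
  ring

/-- In `Γ(s) = ∫ exp(su - e^u) du` the line is moved up by `θ`. This releases the factor `e^(-θτ)`,
while `Re e^(u+iθ) = e^u cos θ` stays positive as long as `θ < π/2`. -/
lemma norm_gamma_le {a θ : ℝ} (ha : 0 < a) (hθ0 : 0 ≤ θ) (hθ : θ < Real.pi / 2) :
    ∃ C, 0 ≤ C ∧ ∀ τ : ℝ, ‖Complex.Gamma (a + Complex.I * τ)‖ ≤ Real.exp (-(θ * τ)) * C := by
  have hc : 0 < Real.cos θ := Real.cos_pos_of_mem_Ioo ⟨by linarith, hθ⟩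
  refine ⟨∫ u : ℝ, Real.exp (a * u - Real.cos θ * Real.exp u),
    integral_nonneg fun u => (Real.exp_pos _).le, fun τ => ?_⟩
  set s : ℂ := a + Complex.I * τ with hs
  have hnorm : ∀ u y : ℝ, ‖Complex.exp (s * (u + y * Complex.I) -
      Complex.exp (u + y * Complex.I))‖ =
      Real.exp (-(y * τ)) * Real.exp (a * u - Real.cos y * Real.exp u) := fun u y => by
    rw [Complex.norm_exp, ← Real.exp_add]
    congr 1
    simp [hs, Complex.exp_re]
    ring
  set E : ℝ := Real.exp (θ * |τ|)
  have hle : ∀ u : ℝ, ∀ y ∈ Set.Icc 0 θ, Real.exp (-(y * τ)) *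
      Real.exp (a * u - Real.cos y * Real.exp u) ≤
      E * Real.exp (a * u - Real.cos θ * Real.exp u) := fun u y hy => by
    have hcos : Real.cos θ ≤ Real.cos y :=
      Real.cos_le_cos_of_nonneg_of_le_pi hy.1 (by linarith [Real.pi_pos]) hy.2
    simp only [E]
    gcongr
    calc -(y * τ) ≤ |y * τ| := neg_le_abs _
      _ = y * |τ| := by rw [abs_mul, abs_of_nonneg hy.1]
      _ ≤ _ := by gcongr; exact hy.2
  have hI0 := integrable_exp_mul_sub_exp ha hc
  have hI1 := integrable_exp_mul_sub_exp (add_pos ha one_pos) hc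
  have hshift := integral_horizontal_shift (f := fun z => Complex.exp (s * z - Complex.exp z))
    (f' := fun z => Complex.exp (s * z - Complex.exp z) * (s - Complex.exp z)) (θ := θ)
    (B := fun u => (E * (1 + ‖s‖)) * Real.exp (a * u - Real.cos θ * Real.exp u) +
      E * Real.exp ((a + 1) * u - Real.cos θ * Real.exp u)) hθ0
    (fun z => by
      simpa using (((hasDerivAt_id z).const_mul s).sub (Complex.hasDerivAt_exp z)).cexp)
    (by fun_prop) ((hI0.const_mul _).add (hI1.const_mul _))
    (fun u y hy => by
      rw [hnorm]
      refine (hle u y hy).trans ?_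
      have : 0 ≤ E * ‖s‖ * Real.exp (a * u - Real.cos θ * Real.exp u) := by positivity
      have : 0 ≤ E * Real.exp ((a + 1) * u - Real.cos θ * Real.exp u) := by positivity
      linarith)
    (fun u y hy => by
      rw [norm_mul, hnorm]
      have h1 : ‖s - Complex.exp (u + y * Complex.I)‖ ≤ ‖s‖ + Real.exp u := by
        refine (norm_sub_le _ _).trans ?_
        rw [Complex.norm_exp]; simp
      calc _ ≤ (E * Real.exp (a * u - Real.cos θ * Real.exp u)) * (‖s‖ + Real.exp u) :=
            mul_le_mul (hle u y hy) h1 (norm_nonneg _) (by positivity)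
        _ ≤ _ := by
          have : Real.exp ((a + 1) * u - Real.cos θ * Real.exp u) =
            Real.exp (a * u - Real.cos θ * Real.exp u) * Real.exp u := by
              rw [← Real.exp_add]; congr 1; ring
          rw [this]
          have : 0 ≤ E * Real.exp (a * u - Real.cos θ * Real.exp u) := by positivity
          linarith)
  rw [gamma_eq_integral_exp (by simpa [hs] using ha), ← hshift]
  refine (norm_integral_le_integral_norm _).trans (le_of_eq ?_)
  simp_rw [hnorm]
  rw [integral_const_mul]

/-- Any rate below `π` could be reached. The rate `7π/8` (twice `θ = 7π/16`) suffices: with the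
decay `π/4` of `K_{iτ}` it beats the growth `π` of `sinh(πτ)`, with room for a factor `|τ|`. -/
lemma exists_gammaSq_le {a : ℝ} (ha : 0 < a) :
    ∃ C, 0 ≤ C ∧ ∀ τ, gammaSq a τ ≤ C * Real.exp (-(7 * Real.pi / 8 * |τ|)) := by
  have hπ := Real.pi_pos
  set θ := 7 * Real.pi / 16
  obtain ⟨C, hC, hle⟩ := norm_gamma_le ha (θ := θ) (by positivity) (by simp only [θ]; linarith)
  refine ⟨C ^ 2, by positivity, fun τ => ?_⟩
  have h : gammaSq a |τ| = gammaSq a τ := by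
    rcases abs_choice τ with h | h <;> rw [h]; exact gammaSq_neg a τ
  rw [← h, gammaSq]
  calc _ ≤ (Real.exp (-(θ * |τ|)) * C) ^ 2 := by gcongr; exact hle _
    _ = _ := by
        rw [mul_pow, ← Real.exp_nat_mul, mul_comm]; congr 2; simp only [θ]; push_cast; ring

lemma gammaSq_add_one {a τ : ℝ} (h : a ≠ 0 ∨ τ ≠ 0) :
    gammaSq (a + 1) τ = (a ^ 2 + τ ^ 2) * gammaSq a τ := by
  have hz : (a : ℂ) + Complex.I * τ ≠ 0 := by
    intro h0
    have h1 := congrArg Complex.re h0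
    have h2 := congrArg Complex.im h0
    simp at h1 h2
    tauto
  have : ((a + 1 : ℝ) : ℂ) + Complex.I * τ = (a + Complex.I * τ) + 1 := by push_cast; ring
  rw [gammaSq, this, Complex.Gamma_add_one _ hz, norm_mul, mul_pow, ← gammaSq,
    ← Complex.normSq_eq_norm_sq, Complex.normSq_apply]
  simp
  left; ring

lemma gammaSq_one_mul_sinh (τ : ℝ) : gammaSq 1 τ * Real.sinh (Real.pi * τ) = Real.pi * τ := by
  rcases eq_or_ne τ 0 with rfl | hτ
  · simp
  have h1 := gamma_mul_gamma_eq_gammaSq 1 τ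
  have h2 := Complex.Gamma_mul_Gamma_one_sub (Complex.I * τ)
  have h0 : Complex.I * (τ : ℂ) ≠ 0 := by simp [hτ]
  have h3 : Complex.sin (Real.pi * (Complex.I * τ)) = Complex.I * Complex.sinh (Real.pi * τ) := by
    rw [show (Real.pi : ℂ) * (Complex.I * τ) = (Real.pi * τ) * Complex.I by ring,
      Complex.sin_mul_I]; ring
  have hs : Complex.sinh (Real.pi * τ) ≠ 0 := by
    rw [← Complex.ofReal_mul, ← Complex.ofReal_sinh, Complex.ofReal_ne_zero]
    exact Real.sinh_ne_zero.mpr (by positivity)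
  rw [Complex.ofReal_one, add_comm (1 : ℂ), Complex.Gamma_add_one _ h0, mul_assoc, h2, h3] at h1
  have : ((gammaSq 1 τ * Real.sinh (Real.pi * τ) : ℝ) : ℂ) = ((Real.pi * τ : ℝ) : ℂ) := by
    push_cast
    rw [← h1, mul_div_assoc', div_mul_eq_mul_div, div_eq_iff (by simp [hs])]
    ring
  exact_mod_cast this

lemma inv_gammaSq_zero (τ : ℝ) : (gammaSq 0 τ)⁻¹ = τ * Real.sinh (Real.pi * τ) / Real.pi := by
  rcases eq_or_ne τ 0 with rfl | hτ
  -- At `τ = 0` the convention `Γ(0) = 0`, together with `0⁻¹ = 0`, makes both sides vanish.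
  · simp [gammaSq]
  have h1 := gammaSq_one_mul_sinh τ
  have h2 := gammaSq_add_one (a := 0) (τ := τ) (Or.inr hτ)
  rw [zero_add] at h2
  rw [h2] at h1
  have hg : gammaSq 0 τ ≠ 0 := by
    intro h; rw [h] at h1; simp [hτ] at h1
  have hπ := Real.pi_ne_zero
  rw [inv_eq_iff_eq_inv, inv_div, eq_div_iff_mul_eq]
  · apply mul_left_cancel₀ hτ
    linear_combination h1
  · exact mul_ne_zero hτ (Real.sinh_ne_zero.mpr (mul_ne_zero hπ hτ))

/-! ### Fourier pairs linking powers of `cosh` and `|Γ(a+iτ)|²` -/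

lemma two_add_two_cosh_pos (u : ℝ) : 0 < 2 + 2 * Real.cosh u := by
  have := Real.cosh_pos u; linarith

lemma sigmoid_mul_sigmoid_neg (u : ℝ) :
    Real.sigmoid u * Real.sigmoid (-u) = (2 + 2 * Real.cosh u)⁻¹ := by
  rw [Real.sigmoid_def, Real.sigmoid_def, ← mul_inv, neg_neg, Real.cosh_eq]
  congr 1
  have : Real.exp (-u) * Real.exp u = 1 := by rw [← Real.exp_add]; simp
  linear_combination this

/-- The Fourier transform of `(2 + 2 cosh u)^{-a}` is `|Γ(a + iτ)|² / Γ(2a)`. -/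
lemma integral_cexp_mul_cosh_rpow {a : ℝ} (ha : 0 < a) (τ : ℝ) :
    ∫ u : ℝ, Complex.exp (Complex.I * τ * u) * (((2 + 2 * Real.cosh u) ^ (-a) : ℝ) : ℂ) =
      ((gammaSq a τ / Real.Gamma (2 * a) : ℝ) : ℂ) := by
  have hG : Complex.Gamma (2 * a) ≠ 0 := by
    have := (Real.Gamma_pos_of_pos (show 0 < 2 * a by positivity)).ne'
    have h := Complex.ofReal_ne_zero.mpr this
    rw [← Complex.Gamma_ofReal] at h
    push_cast at h
    exact h
  have hbeta := Complex.Gamma_mul_Gamma_eq_betaIntegral (s := a + Complex.I * τ)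
    (t := a - Complex.I * τ) (by simpa using ha) (by simpa using ha)
  rw [gamma_mul_gamma_eq_gammaSq, show (a : ℂ) + Complex.I * τ + (a - Complex.I * τ) = 2 * a by ring]
    at hbeta
  have h2 : ((gammaSq a τ / Real.Gamma (2 * a) : ℝ) : ℂ) =
      Complex.betaIntegral (a + Complex.I * τ) (a - Complex.I * τ) := by
    rw [Complex.ofReal_div, hbeta, ← Complex.Gamma_ofReal]
    push_cast
    rw [mul_div_cancel_left₀ _ hG]
  -- Substitute `t = sigmoid u` in the beta integral: `log (t/(1-t)) = u` produces the Fourier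
  -- kernel, and `dt = t(1-t) du` with `t(1-t) = (2 + 2 cosh u)⁻¹` produces the power.
  rw [h2, Complex.betaIntegral, intervalIntegral.integral_of_le zero_le_one,
    integral_Ioc_eq_integral_Ioo, ← Real.range_sigmoid, ← Set.image_univ,
    integral_image_eq_integral_abs_deriv_smul MeasurableSet.univ
      (fun x _ => (Real.hasDerivAt_sigmoid x).hasDerivWithinAt) Real.sigmoid_injective.injOn,
    setIntegral_univ]
  refine integral_congr_ae (Filter.Eventually.of_forall fun u => ?_)
  have hp := Real.sigmoid_pos u
  have hq := Real.sigmoid_pos (-u)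
  have h1 : (1 : ℂ) - (Real.sigmoid u : ℂ) = ((Real.sigmoid (-u) : ℝ) : ℂ) := by
    rw [Real.sigmoid_neg]; push_cast; rfl
  have hlog : Real.log (Real.sigmoid u) - Real.log (Real.sigmoid (-u)) = u := by
    rw [← Real.sigmoid_mul_rexp_neg u, Real.log_mul hp.ne' (Real.exp_pos _).ne', Real.log_exp]; ring
  simp only
  rw [h1, ← Real.sigmoid_neg, abs_of_pos (by positivity), Complex.real_smul,
    Complex.cpow_def_of_ne_zero (by exact_mod_cast hp.ne'),
    Complex.cpow_def_of_ne_zero (by exact_mod_cast hq.ne'), ← Complex.ofReal_log hp.le,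
    ← Complex.ofReal_log hq.le, ← Complex.exp_add]
  have hr : (2 + 2 * Real.cosh u) ^ (-a) =
      Real.exp (a * (Real.log (Real.sigmoid u) + Real.log (Real.sigmoid (-u)))) := by
    rw [← Real.log_mul hp.ne' hq.ne', sigmoid_mul_sigmoid_neg, mul_comm a, Real.log_inv,
      Real.rpow_def_of_pos (two_add_two_cosh_pos u)]
    congr 1; ring
  have hm : Real.sigmoid u * Real.sigmoid (-u) =
      Real.exp (Real.log (Real.sigmoid u) + Real.log (Real.sigmoid (-u))) := by
    rw [Real.exp_add, Real.exp_log hp, Real.exp_log hq]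
  rw [hr, hm, Complex.ofReal_exp, Complex.ofReal_exp, ← Complex.exp_add, ← Complex.exp_add]
  congr 1
  push_cast
  have hlog' : (u : ℂ) = Real.log (Real.sigmoid u) - Real.log (Real.sigmoid (-u)) := by
    exact_mod_cast hlog.symm
  rw [hlog']
  ring

lemma cosh_le_two_add_two_cosh (u : ℝ) : Real.cosh u ≤ 2 + 2 * Real.cosh u := by
  have := Real.cosh_pos u; linarith

lemma integrable_two_add_two_cosh_rpow {a : ℝ} (ha : 0 < a) :
    Integrable fun u : ℝ => (2 + 2 * Real.cosh u) ^ (-a) := by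
  refine (integrable_cosh_rpow_neg ha).mono' (Continuous.aestronglyMeasurable ?_)
    (Filter.Eventually.of_forall fun u => ?_)
  · exact Continuous.rpow_const (by fun_prop) (fun u => Or.inl (two_add_two_cosh_pos u).ne')
  · rw [Real.norm_of_nonneg (Real.rpow_nonneg (two_add_two_cosh_pos u).le _)]
    exact Real.rpow_le_rpow_of_nonpos (Real.cosh_pos u) (cosh_le_two_add_two_cosh u) (by linarith)

lemma integral_re_cexp_I {f : ℝ → ℝ} (hf : Integrable f) (τ : ℝ) :
    (∫ u : ℝ, Complex.exp (Complex.I * τ * u) * (f u : ℂ)).re = ∫ u, Real.cos (τ * u) * f u := by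
  have hi : Integrable fun u : ℝ => Complex.exp (Complex.I * τ * u) * (f u : ℂ) := by
    refine hf.norm.mono' ((Continuous.aestronglyMeasurable (by fun_prop)).mul
      (Complex.continuous_ofReal.comp_aestronglyMeasurable hf.aestronglyMeasurable)) (Filter.Eventually.of_forall fun u => ?_)
    rw [norm_mul, Complex.norm_exp]
    simp
  have h := integral_re hi
  simp only [RCLike.re_to_complex] at h
  rw [← h]
  refine integral_congr_ae (Filter.Eventually.of_forall fun u => ?_)
  simp [Complex.exp_re]

lemma integral_cos_mul_cosh_rpow {a : ℝ} (ha : 0 < a) (τ : ℝ) :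
    ∫ u : ℝ, Real.cos (τ * u) * (2 + 2 * Real.cosh u) ^ (-a) =
      gammaSq a τ / Real.Gamma (2 * a) := by
  rw [← integral_re_cexp_I (integrable_two_add_two_cosh_rpow ha), integral_cexp_mul_cosh_rpow ha,
    Complex.ofReal_re]

lemma integrable_gammaSq {a : ℝ} (ha : 0 < a) : Integrable (gammaSq a) := by
  obtain ⟨C, -, hle⟩ := exists_gammaSq_le ha
  have hπ := Real.pi_pos
  refine ((integrable_exp_neg_mul_abs (c := 7 * Real.pi / 8) (by positivity)).const_mul C).mono'
    (continuous_gammaSq ha).aestronglyMeasurable (Filter.Eventually.of_forall fun u => ?_)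
  rw [Real.norm_of_nonneg (gammaSq_nonneg _ _)]
  exact hle u

/-- Fourier inversion of the preceding transform; continuity, the power decay in `u` and the
exponential decay in `τ` justify it pointwise. -/
lemma integral_cos_mul_gammaSq {a : ℝ} (ha : 0 < a) (s : ℝ) :
    ∫ τ : ℝ, Real.cos (s * τ) * gammaSq a τ =
      2 * Real.pi * Real.Gamma (2 * a) * (2 + 2 * Real.cosh s) ^ (-a) := by
  have hπ := Real.pi_pos
  have hG := Real.Gamma_pos_of_pos (show 0 < 2 * a by positivity)
  set f : ℝ → ℂ := fun u => (((2 + 2 * Real.cosh u) ^ (-a) : ℝ) : ℂ) with hf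
  have hfc : Continuous f := Complex.continuous_ofReal.comp
    (Continuous.rpow_const (by fun_prop) (fun u => Or.inl (two_add_two_cosh_pos u).ne'))
  have hfi : Integrable f := (integrable_two_add_two_cosh_rpow ha).ofReal
  have hF : FourierTransform.fourier f =
      fun w : ℝ => ((gammaSq a (2 * Real.pi * w) / Real.Gamma (2 * a) : ℝ) : ℂ) := by
    ext w
    -- The Fourier kernel is `e^(-2πiuw)`, so the frequency is `-2πw`; evenness of `gammaSq` absorbs
    -- the sign.
    rw [Real.fourier_real_eq_integral_exp_smul, ← gammaSq_neg, ← integral_cexp_mul_cosh_rpow ha]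
    refine integral_congr_ae (Filter.Eventually.of_forall fun u => ?_)
    simp only [hf, smul_eq_mul]
    congr 2
    push_cast
    ring
  have hgi : Integrable fun w : ℝ => gammaSq a (2 * Real.pi * w) :=
    (integrable_gammaSq ha).comp_mul_left' (by positivity)
  have hFi : Integrable (FourierTransform.fourier f) := by
    rw [hF]; exact (hgi.div_const _).ofReal
  have hinv := congrFun (hfc.fourierInv_fourier_eq hfi hFi) s
  rw [Real.fourierInv_eq', hF] at hinv
  have hre := integral_re_cexp_I (integrable_gammaSq ha) s
  rw [← hre]
  have hsub := Measure.integral_comp_mul_left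
    (fun τ : ℝ => Complex.exp (Complex.I * s * τ) * (gammaSq a τ : ℂ)) (2 * Real.pi)
  have h1 : ∫ w : ℝ, Complex.exp (Complex.I * s * ((2 * Real.pi * w : ℝ) : ℂ)) *
      (gammaSq a (2 * Real.pi * w) : ℂ) = Real.Gamma (2 * a) * f s := by
    rw [← hinv, ← integral_const_mul]
    refine integral_congr_ae (Filter.Eventually.of_forall fun w => ?_)
    simp only [smul_eq_mul]
    have hGc : (Real.Gamma (2 * a) : ℂ) ≠ 0 := by exact_mod_cast hG.ne'
    rw [Complex.ofReal_div, mul_div_assoc', mul_div_cancel₀ _ hGc]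
    congr 2
    simp
    ring
  rw [h1, abs_of_pos (by positivity), Complex.real_smul, hf, ← Complex.ofReal_mul] at hsub
  have h2 := congrArg Complex.re hsub
  rw [Complex.re_ofReal_mul, Complex.ofReal_re] at h2
  rw [inv_mul_eq_div, eq_div_iff (by positivity)] at h2
  rw [← h2]
  ring

lemma abs_le_exp_pi_div_sixteen (τ : ℝ) :
    |τ| ≤ 16 / Real.pi * Real.exp (Real.pi / 16 * |τ|) := by
  have hπ := Real.pi_pos
  have := Real.add_one_le_exp (Real.pi / 16 * |τ|)
  rw [div_mul_eq_mul_div, le_div_iff₀ hπ]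
  linarith

lemma exists_abs_mul_gammaSq_le {a : ℝ} (ha : 0 < a) :
    ∃ C, 0 ≤ C ∧ ∀ τ, |τ| * gammaSq a τ ≤ C * Real.exp (-(13 * Real.pi / 16 * |τ|)) := by
  obtain ⟨C, hC, hle⟩ := exists_gammaSq_le ha
  have hπ := Real.pi_pos
  refine ⟨16 / Real.pi * C, by positivity, fun τ => ?_⟩
  calc _ ≤ (16 / Real.pi * Real.exp (Real.pi / 16 * |τ|)) *
        (C * Real.exp (-(7 * Real.pi / 8 * |τ|))) :=
        mul_le_mul (abs_le_exp_pi_div_sixteen τ) (hle τ) (gammaSq_nonneg _ _) (by positivity)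
    _ = 16 / Real.pi * C * (Real.exp (Real.pi / 16 * |τ|) *
        Real.exp (-(7 * Real.pi / 8 * |τ|))) := by ring
    _ = _ := by rw [← Real.exp_add]; congr 2; ring

lemma integrable_abs_mul_gammaSq {a : ℝ} (ha : 0 < a) :
    Integrable fun τ => |τ| * gammaSq a τ := by
  obtain ⟨C, -, hle⟩ := exists_abs_mul_gammaSq_le ha
  have hπ := Real.pi_pos
  refine ((integrable_exp_neg_mul_abs (c := 13 * Real.pi / 16) (by positivity)).const_mul C).mono'
    (continuous_abs.mul (continuous_gammaSq ha)).aestronglyMeasurable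
    (Filter.Eventually.of_forall fun u => ?_)
  rw [Real.norm_of_nonneg (mul_nonneg (abs_nonneg _) (gammaSq_nonneg _ _))]
  exact hle u

/-- Differentiate the cosine transform of `|Γ(a+iτ)|²` in `s` under the integral sign, with
dominating function `|τ| |Γ(a+iτ)|²`. -/
lemma integral_mul_sin_mul_gammaSq {a : ℝ} (ha : 0 < a) (s : ℝ) :
    ∫ τ : ℝ, τ * Real.sin (s * τ) * gammaSq a τ =
      4 * Real.pi * a * Real.Gamma (2 * a) * Real.sinh s * (2 + 2 * Real.cosh s) ^ (-a - 1) := by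
  have hcont := continuous_gammaSq ha
  have hd := (hasDerivAt_integral_of_dominated_loc_of_deriv_le (μ := volume) (s := Set.univ)
    (F := fun s τ => Real.cos (s * τ) * gammaSq a τ)
    (F' := fun s τ => -(τ * Real.sin (s * τ) * gammaSq a τ)) (x₀ := s)
    (bound := fun τ => |τ| * gammaSq a τ) Filter.univ_mem
    (Filter.Eventually.of_forall fun s => Continuous.aestronglyMeasurable (by fun_prop))
    ((integrable_gammaSq ha).mono (Continuous.aestronglyMeasurable (by fun_prop))
      (Filter.Eventually.of_forall fun τ => ?_))
    (Continuous.aestronglyMeasurable (by fun_prop))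
    (Filter.Eventually.of_forall fun τ s _ => ?_) (integrable_abs_mul_gammaSq ha)
    (Filter.Eventually.of_forall fun τ s _ => ?_)).2
  · simp_rw [integral_cos_mul_gammaSq ha] at hd
    have hd2 : HasDerivAt (fun s => 2 * Real.pi * Real.Gamma (2 * a) *
        (2 + 2 * Real.cosh s) ^ (-a)) (2 * Real.pi * Real.Gamma (2 * a) *
          (2 * Real.sinh s * (-a) * (2 + 2 * Real.cosh s) ^ (-a - 1))) s :=
      ((((Real.hasDerivAt_cosh s).const_mul 2).const_add 2).rpow_const
        (Or.inl (two_add_two_cosh_pos s).ne')).const_mul _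
    have := hd.unique hd2
    rw [integral_neg] at this
    linear_combination -this
  · rw [norm_mul]
    exact mul_le_of_le_one_left (norm_nonneg _) (Real.abs_cos_le_one _)
  · rw [norm_neg, norm_mul, norm_mul, Real.norm_of_nonneg (gammaSq_nonneg a τ)]
    refine mul_le_mul_of_nonneg_right ?_ (gammaSq_nonneg _ _)
    exact mul_le_of_le_one_right (norm_nonneg _) (Real.abs_sin_le_one _)
  · have h1 : HasDerivAt (fun s : ℝ => s * τ) τ s := by
      simpa using (hasDerivAt_id s).mul_const τ
    convert! (h1.cos.mul_const (gammaSq a τ)) using 1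
    ring

/-- The two denominators on the right multiply to `4 (cosh s + cosh u)²`. The identity writes the
derivative of `(cosh s + cosh u)⁻¹` through two translates of a function whose Fourier transform is
`|Γ(1+iτ)|²`. -/
lemma sinh_mul_deriv_inv_cosh_add {s : ℝ} (u : ℝ) :
    Real.sinh s * (-Real.sinh u / (Real.cosh s + Real.cosh u) ^ 2) =
      (2 + 2 * Real.cosh (u + s))⁻¹ - (2 + 2 * Real.cosh (u - s))⁻¹ := by
  have h0 : Real.cosh s + Real.cosh u ≠ 0 := by
    have := Real.cosh_pos s; have := Real.cosh_pos u; positivity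
  have h1 := (two_add_two_cosh_pos (u + s)).ne'
  have h2 := (two_add_two_cosh_pos (u - s)).ne'
  have hs := Real.cosh_sq s
  have hu := Real.cosh_sq u
  rw [inv_sub_inv h1 h2, mul_div_assoc', div_eq_div_iff (by positivity) (by positivity)]
  rw [Real.cosh_add, Real.cosh_sub]
  have h3 : (2 + 2 * (Real.cosh u * Real.cosh s + Real.sinh u * Real.sinh s)) *
      (2 + 2 * (Real.cosh u * Real.cosh s - Real.sinh u * Real.sinh s)) =
      4 * (Real.cosh s + Real.cosh u) ^ 2 := by
    linear_combination (4 * Real.sinh s ^ 2) * hu + 4 * (Real.cosh u ^ 2 - 1) * hs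
  rw [h3]
  ring

lemma integrable_inv_const_add_cosh {p : ℝ} (hp : 0 ≤ p) :
    Integrable fun u : ℝ => (p + Real.cosh u)⁻¹ := by
  have hpos : ∀ u : ℝ, 0 < p + Real.cosh u := fun u => by have := Real.cosh_pos u; linarith
  refine (integrable_cosh_rpow_neg one_pos).mono' (Continuous.aestronglyMeasurable
    (Continuous.inv₀ (by fun_prop) fun u => (hpos u).ne')) (Filter.Eventually.of_forall fun u => ?_)
  rw [Real.norm_of_nonneg (inv_nonneg.mpr (hpos u).le), Real.rpow_neg_one]
  exact inv_anti₀ (Real.cosh_pos u) (by linarith)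

/-- Integration by parts trades the factor `iτ` for the derivative of `(cosh s + cosh u)⁻¹`, a
difference of translates by `±s`. Its Fourier transform is `|Γ(1+iτ)|²` times a multiple of
`sin(sτ)`, and the reflection formula `|Γ(1+iτ)|² sinh(πτ) = πτ` finishes. -/
lemma sinh_mul_integral_cos_div {s : ℝ} (hs : 0 < s) (τ : ℝ) :
    Real.sinh (Real.pi * τ) * ∫ u : ℝ, Real.cos (τ * u) * (Real.cosh s + Real.cosh u)⁻¹ =
      2 * Real.pi * Real.sin (s * τ) / Real.sinh s := by
  rcases eq_or_ne τ 0 with rfl | hτ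
  · simp
  have hss : 0 < Real.sinh s := Real.sinh_pos_iff.mpr hs
  have hpos : ∀ u : ℝ, 0 < Real.cosh s + Real.cosh u := fun u => by
    have := Real.cosh_pos u; have := Real.cosh_pos s; linarith
  set D : ℝ → ℂ := fun u => (((Real.cosh s + Real.cosh u)⁻¹ : ℝ) : ℂ) with hD
  set D' : ℝ → ℂ := fun u => ((-Real.sinh u / (Real.cosh s + Real.cosh u) ^ 2 : ℝ) : ℂ) with hD'
  set q : ℝ → ℂ := fun u => (((2 + 2 * Real.cosh u) ^ (-1 : ℝ) : ℝ) : ℂ) with hq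
  have hqi : Integrable q := (integrable_two_add_two_cosh_rpow one_pos).ofReal
  have hDi : Integrable D := (integrable_inv_const_add_cosh (Real.cosh_pos s).le).ofReal
  have hDq : ∀ u, D' u = (Real.sinh s : ℂ)⁻¹ * (q (u + s) - q (u - s)) := fun u => by
    have hsc : (Real.sinh s : ℂ) ≠ 0 := by exact_mod_cast hss.ne'
    rw [eq_inv_mul_iff_mul_eq₀ hsc]
    simp only [hD', hq, Real.rpow_neg_one]
    rw [← Complex.ofReal_mul, sinh_mul_deriv_inv_cosh_add, Complex.ofReal_sub]
  have hE : ∀ {f : ℝ → ℂ}, Integrable f → Integrable fun u : ℝ =>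
      Complex.exp (Complex.I * τ * u) * f u := fun {f} hf => by
    refine hf.norm.mono' ((Continuous.aestronglyMeasurable (by fun_prop)).mul
      hf.aestronglyMeasurable) (Filter.Eventually.of_forall fun u => ?_)
    rw [norm_mul, Complex.norm_exp]
    simp
  have hD'i : Integrable D' := by
    rw [funext hDq]
    exact ((hqi.comp_add_right s).sub (hqi.comp_sub_right s)).const_mul _
  have hIτ : Complex.I * (τ : ℂ) ≠ 0 := by simp [hτ]
  have hibp := integral_mul_deriv_eq_deriv_mul_of_integrable
    (u := fun u : ℝ => Complex.exp (Complex.I * τ * u)) (v := D) (v' := D')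
    (u' := fun u : ℝ => Complex.exp (Complex.I * τ * u) * (Complex.I * τ))
    (fun u _ => by
      have : HasDerivAt (fun z : ℂ => Complex.exp (Complex.I * τ * z))
        (Complex.exp (Complex.I * τ * u) * (Complex.I * τ)) (u : ℂ) := by
          simpa using ((hasDerivAt_id (u : ℂ)).const_mul (Complex.I * (τ : ℂ))).cexp
      exact this.comp_ofReal)
    (fun u _ => by
      exact (((Real.hasDerivAt_cosh u).const_add (Real.cosh s)).inv (hpos u).ne').ofReal_comp)
    (hE hD'i)
    (((hE hDi).const_mul (Complex.I * τ)).congr (Filter.Eventually.of_forall fun u => by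
      simp only [Pi.mul_apply]; ring))
    (hE hDi)
  have hq0 : ∫ u : ℝ, Complex.exp (Complex.I * τ * u) * q u = (gammaSq 1 τ : ℂ) := by
    rw [integral_cexp_mul_cosh_rpow one_pos]
    simp
  have hqs : ∀ c : ℝ, ∫ u : ℝ, Complex.exp (Complex.I * τ * u) * q (u + c) =
      Complex.exp (-(Complex.I * τ * c)) * gammaSq 1 τ := fun c => by
    rw [← hq0, ← integral_add_right_eq_self
      (fun u : ℝ => Complex.exp (Complex.I * τ * u) * q u) c, ← integral_const_mul]
    refine integral_congr_ae (Filter.Eventually.of_forall fun u => ?_)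
    simp only
    rw [← mul_assoc, ← Complex.exp_add]
    congr 2
    push_cast
    ring
  have hL : ∫ u : ℝ, Complex.exp (Complex.I * τ * u) * D' u = (Real.sinh s : ℂ)⁻¹ *
      ((Complex.exp (-(Complex.I * τ * s)) - Complex.exp (Complex.I * τ * s)) * gammaSq 1 τ) := by
    have h2 := hqs (-s)
    simp only [← sub_eq_add_neg] at h2
    rw [show -(Complex.I * τ * ((-s : ℝ) : ℂ)) = Complex.I * τ * s by push_cast; ring] at h2
    rw [sub_mul, ← hqs s, ← h2, ← integral_sub (hE (hqi.comp_add_right s))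
      (hE (hqi.comp_sub_right s)), ← integral_const_mul]
    refine integral_congr_ae (Filter.Eventually.of_forall fun u => ?_)
    simp only [hDq]
    ring
  have hR : ∫ u : ℝ, Complex.exp (Complex.I * τ * u) * (Complex.I * τ) * D u =
      Complex.I * τ * ∫ u : ℝ, Complex.exp (Complex.I * τ * u) * D u := by
    rw [← integral_const_mul]
    refine integral_congr_ae (Filter.Eventually.of_forall fun u => ?_)
    simp only
    ring
  rw [hL, hR] at hibp
  have hsin : Complex.exp (-(Complex.I * τ * s)) - Complex.exp (Complex.I * τ * s) =
      -(2 * Complex.I * ((Real.sin (s * τ) : ℝ) : ℂ)) := by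
    rw [Complex.ofReal_sin, Complex.sin]
    push_cast
    rw [show -((s : ℂ) * τ) * Complex.I = -(Complex.I * τ * s) by ring,
      show (s : ℂ) * τ * Complex.I = Complex.I * τ * s by ring]
    linear_combination (Complex.exp (-(Complex.I * τ * s)) - Complex.exp (Complex.I * τ * s)) *
      Complex.I_sq
  rw [hsin] at hibp
  have hfin : ∫ u : ℝ, Complex.exp (Complex.I * τ * u) * D u =
      ((2 * Real.sin (s * τ) * gammaSq 1 τ / (τ * Real.sinh s) : ℝ) : ℂ) := by
    apply mul_left_cancel₀ hIτ
    have hsc : (Real.sinh s : ℂ) ≠ 0 := by exact_mod_cast hss.ne'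
    have hτc : (τ : ℂ) ≠ 0 := by exact_mod_cast hτ
    rw [← neg_inj, ← hibp]
    push_cast at hsc ⊢
    field_simp
  have hre := integral_re_cexp_I (integrable_inv_const_add_cosh (Real.cosh_pos s).le) τ
  rw [← hre, hfin, Complex.ofReal_re]
  have hA := gammaSq_one_mul_sinh τ
  rw [mul_div_assoc', div_eq_div_iff (by positivity) (by positivity)]
  linear_combination (2 * Real.sin (s * τ) * Real.sinh s) * hA

/-! ### Estimates and integral transforms of the Macdonald function -/

/-- The exponential is split into two equal factors: one is spent on the power `(x cosh u)^(-ε)`,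
the other, by `cosh u ≥ 1`, on `e^(-x/4)`. The resulting majorant is a function of `x` times a
function of `u`. -/
lemma exp_neg_mul_cosh_le {ε x : ℝ} (hε : 0 < ε) (hx : 0 < x) (u : ℝ) :
    Real.exp (-(x * Real.cosh u / 2)) ≤
      (4 * ε) ^ ε * (x ^ (-ε) * Real.exp (-(x / 4))) * Real.cosh u ^ (-ε) := by
  have hc := Real.one_le_cosh u
  have hc0 := Real.cosh_pos u
  have h1 := exp_neg_le_rpow_neg (z := x * Real.cosh u / 4) hε (by positivity)
  rw [Real.div_rpow (by positivity) (by norm_num), Real.mul_rpow hx.le hc0.le,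
    Real.rpow_neg (by norm_num : (0 : ℝ) ≤ 4), div_inv_eq_mul] at h1
  have h2 : Real.exp (-(x * Real.cosh u / 4)) ≤ Real.exp (-(x / 4)) := by
    gcongr; nlinarith
  calc Real.exp (-(x * Real.cosh u / 2))
      = Real.exp (-(x * Real.cosh u / 4)) * Real.exp (-(x * Real.cosh u / 4)) := by
        rw [← Real.exp_add]; congr 1; ring
    _ ≤ (ε ^ ε * (x ^ (-ε) * Real.cosh u ^ (-ε) * 4 ^ ε)) * Real.exp (-(x / 4)) := by
        gcongr
    _ = _ := by rw [Real.mul_rpow (by norm_num) hε.le]; ring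

lemma integrable_exp_neg_mul_cosh {x : ℝ} (hx : 0 < x) :
    Integrable fun u : ℝ => Real.exp (-(x * Real.cosh u)) := by
  refine ((integrable_cosh_rpow_neg one_pos).const_mul
    ((4 * 1) ^ (1 : ℝ) * ((2 * x) ^ (-1 : ℝ) * Real.exp (-(2 * x / 4))))).mono'
    (Continuous.aestronglyMeasurable (by fun_prop)) (Filter.Eventually.of_forall fun u => ?_)
  rw [Real.norm_of_nonneg (Real.exp_pos _).le]
  have := exp_neg_mul_cosh_le one_pos (show 0 < 2 * x by positivity) u
  rwa [show 2 * x * Real.cosh u / 2 = x * Real.cosh u by ring] at this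

lemma integrable_cosh_mul_exp_neg_mul_cosh {x : ℝ} (hx : 0 < x) :
    Integrable fun u : ℝ => Real.cosh u * Real.exp (-(x * Real.cosh u)) := by
  refine ((integrable_exp_neg_mul_cosh (half_pos hx)).const_mul (2 / x)).mono'
    (Continuous.aestronglyMeasurable (by fun_prop)) (Filter.Eventually.of_forall fun u => ?_)
  have hc := Real.cosh_pos u
  rw [Real.norm_of_nonneg (by positivity)]
  have h1 := Real.add_one_le_exp (x / 2 * Real.cosh u)
  calc _ = Real.cosh u * (Real.exp (-(x / 2 * Real.cosh u)) *
        Real.exp (-(x / 2 * Real.cosh u))) := by rw [← Real.exp_add]; congr 2; ring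
    _ ≤ (2 / x * Real.exp (x / 2 * Real.cosh u)) * (Real.exp (-(x / 2 * Real.cosh u)) *
        Real.exp (-(x / 2 * Real.cosh u))) := by
        gcongr
        rw [div_mul_eq_mul_div, le_div_iff₀ hx]
        linarith
    _ = 2 / x * (Real.exp (x / 2 * Real.cosh u) * Real.exp (-(x / 2 * Real.cosh u))) *
        Real.exp (-(x / 2 * Real.cosh u)) := by ring
    _ = _ := by rw [← Real.exp_add]; simp

lemma macdonaldK_eq_integral (τ x : ℝ) :
    macdonaldK τ x = 2⁻¹ * ∫ u : ℝ, Real.cos (τ * u) * Real.exp (-(x * Real.cosh u)) := by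
  have h := integral_comp_abs (f := fun u => Real.exp (-x * Real.cosh u) * Real.cos (τ * u))
  rw [macdonaldK, eq_inv_mul_iff_mul_eq₀ two_ne_zero, ← h]
  refine integral_congr_ae (Filter.Eventually.of_forall fun u => ?_)
  simp only [Real.cosh_abs]
  have : Real.cos (τ * |u|) = Real.cos (τ * u) := by
    rw [← Real.cos_abs (τ * |u|), abs_mul, abs_abs, ← abs_mul, Real.cos_abs]
  rw [this, neg_mul, mul_comm]

lemma macdonaldK_neg (τ x : ℝ) : macdonaldK (-τ) x = macdonaldK τ x := by
  simp [macdonaldK]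

lemma stronglyMeasurable_macdonaldK :
    StronglyMeasurable fun p : ℝ × ℝ => macdonaldK p.1 p.2 := by
  unfold macdonaldK
  exact StronglyMeasurable.integral_prod_right'
    (f := fun p : (ℝ × ℝ) × ℝ => Real.exp (-p.1.2 * Real.cosh p.2) * Real.cos (p.1.1 * p.2))
    (Continuous.stronglyMeasurable (by fun_prop))

lemma norm_complex_sinh_le (z : ℂ) : ‖Complex.sinh z‖ ≤ Real.cosh z.re := by
  rw [Complex.sinh, Real.cosh_eq, norm_div]
  have h := norm_sub_le (Complex.exp z) (Complex.exp (-z))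
  rw [Complex.norm_exp, Complex.norm_exp, Complex.neg_re] at h
  simp only [RCLike.norm_ofNat]
  gcongr

/-- The line of integration is moved up to height `π/4`. The kernel `e^(iτz)` gains `e^(-πτ/4)`, and
`Re cosh(u + iπ/4) = cosh u cos(π/4) ≥ cosh u / 2` keeps the decay in `u`. -/
lemma abs_macdonaldK_le_integral {τ x : ℝ} (hτ : 0 ≤ τ) (hx : 0 < x) :
    |macdonaldK τ x| ≤
      Real.exp (-(Real.pi / 4 * τ)) * ∫ u : ℝ, Real.exp (-(x * Real.cosh u / 2)) := by
  have hπ := Real.pi_pos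
  set θ := Real.pi / 4 with hθ
  have hcos : 1 / 2 ≤ Real.cos θ := by
    rw [hθ, Real.cos_pi_div_four]
    have : (1 : ℝ) ≤ √2 := Real.one_le_sqrt.mpr (by norm_num)
    linarith
  have hnorm : ∀ u y : ℝ, ‖Complex.exp (Complex.I * τ * (u + y * Complex.I) -
      x * Complex.cosh (u + y * Complex.I))‖ =
      Real.exp (-(y * τ) - x * (Real.cosh u * Real.cos y)) := fun u y => by
    have h1 : (Complex.cosh (u + y * Complex.I)).re = Real.cosh u * Real.cos y := by
      rw [Complex.cosh_add, Complex.cosh_mul_I, Complex.sinh_mul_I, Complex.add_re, ← Complex.ofReal_cosh, ← Complex.ofReal_cos,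
        ← Complex.ofReal_sinh, ← Complex.ofReal_sin]
      simp
      exact Or.inl (Complex.cos_ofReal_re y)
    rw [Complex.norm_exp]
    congr 1
    rw [Complex.sub_re, Complex.re_ofReal_mul, h1]
    simp
    ring
  have hle : ∀ u : ℝ, ∀ y ∈ Set.Icc 0 θ, Real.exp (-(y * τ) - x * (Real.cosh u * Real.cos y)) ≤
      Real.exp (-(y * τ)) * Real.exp (-(x * Real.cosh u / 2)) := fun u y hy => by
    have h1 : Real.cos θ ≤ Real.cos y :=
      Real.cos_le_cos_of_nonneg_of_le_pi hy.1 (by rw [hθ]; linarith) hy.2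
    have hc := Real.cosh_pos u
    rw [← Real.exp_add]
    gcongr
    have : x * Real.cosh u * (1 / 2) ≤ x * Real.cosh u * Real.cos y := by
      gcongr; linarith
    linarith
  have hle1 : ∀ u : ℝ, ∀ y ∈ Set.Icc 0 θ, Real.exp (-(y * τ) - x * (Real.cosh u * Real.cos y)) ≤
      Real.exp (-(x / 2 * Real.cosh u)) := fun u y hy => by
    refine (hle u y hy).trans ?_
    rw [show x * Real.cosh u / 2 = x / 2 * Real.cosh u by ring]
    refine mul_le_of_le_one_left (Real.exp_pos _).le (Real.exp_le_one_iff.mpr ?_)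
    have := mul_nonneg hy.1 hτ
    linarith
  have hI0 := integrable_exp_neg_mul_cosh (half_pos hx)
  have hI1 := integrable_cosh_mul_exp_neg_mul_cosh (half_pos hx)
  have hshift := integral_horizontal_shift
    (f := fun z => Complex.exp (Complex.I * τ * z - x * Complex.cosh z))
    (f' := fun z => Complex.exp (Complex.I * τ * z - x * Complex.cosh z) *
      (Complex.I * τ - x * Complex.sinh z)) (θ := θ)
    (B := fun u => (1 + τ) * Real.exp (-(x / 2 * Real.cosh u)) +
      x * (Real.cosh u * Real.exp (-(x / 2 * Real.cosh u)))) (by positivity)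
    (fun z => by
      simpa using (((hasDerivAt_id z).const_mul (Complex.I * (τ : ℂ))).sub
        ((Complex.hasDerivAt_cosh z).const_mul (x : ℂ))).cexp)
    (by fun_prop) ((hI0.const_mul _).add (hI1.const_mul _))
    (fun u y hy => by
      rw [hnorm]
      refine (hle1 u y hy).trans ?_
      have hc := Real.cosh_pos u
      have : 0 ≤ τ * Real.exp (-(x / 2 * Real.cosh u)) := by positivity
      have : 0 ≤ x * (Real.cosh u * Real.exp (-(x / 2 * Real.cosh u))) := by positivity
      linarith)
    (fun u y hy => by
      rw [norm_mul, hnorm]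
      have hc := Real.cosh_pos u
      have h1 : ‖Complex.I * τ - x * Complex.sinh (u + y * Complex.I)‖ ≤ τ + x * Real.cosh u := by
        refine (norm_sub_le _ _).trans ?_
        have h2 := norm_complex_sinh_le (u + y * Complex.I)
        rw [norm_mul, norm_mul, Complex.norm_I, one_mul, Complex.norm_of_nonneg hτ,
          Complex.norm_of_nonneg hx.le]
        have h3 : ((u : ℂ) + y * Complex.I).re = u := by simp
        rw [h3] at h2
        gcongr
      calc _ ≤ Real.exp (-(x / 2 * Real.cosh u)) * (τ + x * Real.cosh u) :=
            mul_le_mul (hle1 u y hy) h1 (norm_nonneg _) (by positivity)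
        _ ≤ _ := by
          have := Real.exp_pos (-(x / 2 * Real.cosh u))
          linarith)
  have hre := integral_re_cexp_I (integrable_exp_neg_mul_cosh hx) τ
  have h0 : (∫ u : ℝ, Complex.exp (Complex.I * τ * u) *
      ((Real.exp (-(x * Real.cosh u)) : ℝ) : ℂ)) =
      ∫ u : ℝ, Complex.exp (Complex.I * τ * u - x * Complex.cosh u) := by
    refine integral_congr_ae (Filter.Eventually.of_forall fun u => ?_)
    simp only
    rw [Complex.ofReal_exp, ← Complex.exp_add]
    congr 1
    push_cast
    ring
  rw [macdonaldK_eq_integral, ← hre, h0, ← hshift, abs_mul]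
  calc _ ≤ 1 * ‖∫ u : ℝ, Complex.exp (Complex.I * τ * (u + θ * Complex.I) -
        x * Complex.cosh (u + θ * Complex.I))‖ := by
        gcongr
        · rw [abs_of_pos (by norm_num)]; norm_num
        · exact Complex.abs_re_le_norm _
    _ ≤ ∫ u : ℝ, ‖Complex.exp (Complex.I * τ * (u + θ * Complex.I) -
        x * Complex.cosh (u + θ * Complex.I))‖ := by
        rw [one_mul]; exact norm_integral_le_integral_norm _
    _ ≤ ∫ u : ℝ, Real.exp (-(θ * τ)) * Real.exp (-(x * Real.cosh u / 2)) := by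
        simp_rw [hnorm]
        refine integral_mono_of_nonneg (Filter.Eventually.of_forall fun u => (Real.exp_pos _).le)
          (Integrable.const_mul ?_ _) (Filter.Eventually.of_forall fun u => ?_)
        · refine hI0.congr (Filter.Eventually.of_forall fun u => ?_)
          simp only
          congr 1
          ring
        · exact hle u θ ⟨by positivity, le_rfl⟩
    _ = _ := integral_const_mul _ _

lemma exists_abs_macdonaldK_le {ε : ℝ} (hε : 0 < ε) :
    ∃ C, 0 ≤ C ∧ ∀ τ x : ℝ, 0 < x → |macdonaldK τ x| ≤
      C * Real.exp (-(Real.pi / 4 * |τ|)) * (x ^ (-ε) * Real.exp (-(x / 4))) := by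
  refine ⟨(4 * ε) ^ ε * ∫ u : ℝ, Real.cosh u ^ (-ε), mul_nonneg (by positivity)
    (integral_nonneg fun u => Real.rpow_nonneg (Real.cosh_pos u).le _), fun τ x hx => ?_⟩
  have h : macdonaldK |τ| x = macdonaldK τ x := by
    rcases abs_choice τ with h | h <;> rw [h]; exact macdonaldK_neg τ x
  rw [← h]
  refine (abs_macdonaldK_le_integral (abs_nonneg τ) hx).trans ?_
  have h1 : ∫ u : ℝ, Real.exp (-(x * Real.cosh u / 2)) ≤
      ∫ u : ℝ, (4 * ε) ^ ε * (x ^ (-ε) * Real.exp (-(x / 4))) * Real.cosh u ^ (-ε) :=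
    integral_mono_of_nonneg (Filter.Eventually.of_forall fun u => (Real.exp_pos _).le)
      ((integrable_cosh_rpow_neg hε).const_mul _)
      (Filter.Eventually.of_forall fun u => exp_neg_mul_cosh_le hε hx u)
  rw [integral_const_mul] at h1
  calc _ ≤ Real.exp (-(Real.pi / 4 * |τ|)) * ((4 * ε) ^ ε * (x ^ (-ε) * Real.exp (-(x / 4))) *
        ∫ u : ℝ, Real.cosh u ^ (-ε)) := by gcongr
    _ = _ := by ring

lemma integrableOn_rpow_mul_exp_neg_mul {b r : ℝ} (hb : 0 < b) (hr : 0 < r) :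
    IntegrableOn (fun x : ℝ => x ^ (b - 1) * Real.exp (-(r * x))) (Set.Ioi 0) := by
  have := integrableOn_rpow_mul_exp_neg_mul_rpow (p := 1) (s := b - 1) (by linarith) one_pos hr
  simpa using this

lemma integrableOn_rpow_mul_macdonaldK {b p : ℝ} (hb : 0 < b) (hp : 0 ≤ p) (τ : ℝ) :
    IntegrableOn (fun x => x ^ (b - 1) * Real.exp (-(p * x)) * macdonaldK τ x) (Set.Ioi 0) := by
  -- The choice `ε = b/2` leaves the exponent `b/2 - 1`, which is integrable at 0.
  obtain ⟨C, hC, hle⟩ := exists_abs_macdonaldK_le (half_pos hb)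
  have hK : StronglyMeasurable fun x => macdonaldK τ x :=
    stronglyMeasurable_macdonaldK.comp_measurable measurable_prodMk_left
  have hi := (integrableOn_rpow_mul_exp_neg_mul (half_pos hb) (show (0 : ℝ) < 1 / 4 by norm_num))
  refine (hi.const_mul (C * Real.exp (-(Real.pi / 4 * |τ|)))).mono'
    ((Measurable.aestronglyMeasurable (by fun_prop)).mul hK.aestronglyMeasurable) ?_
  filter_upwards [ae_restrict_mem measurableSet_Ioi] with x hx
  simp only [Set.mem_Ioi] at hx
  rw [norm_mul, Real.norm_eq_abs (macdonaldK τ x), Real.norm_of_nonneg (by positivity)]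
  have h1 : Real.exp (-(p * x)) ≤ 1 := Real.exp_le_one_iff.mpr (by nlinarith)
  calc _ ≤ x ^ (b - 1) * 1 * (C * Real.exp (-(Real.pi / 4 * |τ|)) *
        (x ^ (-(b / 2)) * Real.exp (-(x / 4)))) := by gcongr; exact hle τ x hx
    _ = C * Real.exp (-(Real.pi / 4 * |τ|)) *
        ((x ^ (b - 1) * x ^ (-(b / 2))) * Real.exp (-(1 / 4 * x))) := by ring_nf
    _ = _ := by rw [← Real.rpow_add hx]; congr 3; ring

/-- Fubini: for fixed `u` the integral over `x` is a Gamma integral with rate `p + cosh u`. -/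
lemma integral_rpow_mul_macdonaldK {b p : ℝ} (hb : 0 < b) (hp : 0 ≤ p) (τ : ℝ) :
    ∫ x in Set.Ioi (0 : ℝ), x ^ (b - 1) * Real.exp (-(p * x)) * macdonaldK τ x =
      Real.Gamma b / 2 * ∫ u : ℝ, Real.cos (τ * u) * (p + Real.cosh u) ^ (-b) := by
  have hb2 := half_pos hb
  have hpos : ∀ u : ℝ, 0 < p + Real.cosh u := fun u => by have := Real.cosh_pos u; linarith
  have hsw := integral_integral_swap (μ := volume.restrict (Set.Ioi (0 : ℝ))) (ν := volume)
    (f := fun x u : ℝ => x ^ (b - 1) * Real.exp (-(p * x)) *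
      (Real.cos (τ * u) * Real.exp (-(x * Real.cosh u)))) (by
    have hB := ((integrableOn_rpow_mul_exp_neg_mul hb2
      (show (0 : ℝ) < 1 / 4 by norm_num)).const_mul ((4 * (b / 2)) ^ (b / 2))).mul_prod
      (integrable_cosh_rpow_neg hb2)
    refine hB.mono' (Measurable.aestronglyMeasurable (by unfold Function.uncurry; fun_prop)) ?_
    have : ∀ᵐ q : ℝ × ℝ ∂((volume.restrict (Set.Ioi 0)).prod volume), q.1 ∈ Set.Ioi (0 : ℝ) := by
      rw [Measure.ae_prod_iff_ae_ae (measurableSet_Ioi.preimage measurable_fst)]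
      filter_upwards [ae_restrict_mem measurableSet_Ioi] with x hx
      exact Filter.Eventually.of_forall fun _ => hx
    filter_upwards [this] with q hq
    obtain ⟨x, u⟩ := q
    simp only [Set.mem_Ioi] at hq
    simp only [Function.uncurry]
    have h1 : Real.exp (-(p * x)) ≤ 1 := Real.exp_le_one_iff.mpr (by nlinarith)
    have hc := Real.cosh_pos u
    have h2 : Real.exp (-(x * Real.cosh u)) ≤ Real.exp (-(x * Real.cosh u / 2)) := by
      gcongr; linarith [mul_pos hq hc]
    rw [norm_mul, norm_mul (Real.cos _), Real.norm_of_nonneg (Real.exp_pos _).le,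
      Real.norm_of_nonneg (by positivity)]
    calc _ ≤ x ^ (b - 1) * 1 * (1 * ((4 * (b / 2)) ^ (b / 2) *
          (x ^ (-(b / 2)) * Real.exp (-(x / 4))) * Real.cosh u ^ (-(b / 2)))) := by
          gcongr
          · exact Real.abs_cos_le_one _
          · exact h2.trans (exp_neg_mul_cosh_le hb2 hq u)
      _ = (4 * (b / 2)) ^ (b / 2) * ((x ^ (b - 1) * x ^ (-(b / 2))) * Real.exp (-(1 / 4 * x))) *
          Real.cosh u ^ (-(b / 2)) := by ring_nf
      _ = _ := by rw [← Real.rpow_add hq]; congr 4; ring)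
  have hL : ∫ x in Set.Ioi (0 : ℝ), x ^ (b - 1) * Real.exp (-(p * x)) * macdonaldK τ x =
      2⁻¹ * ∫ x in Set.Ioi (0 : ℝ), ∫ u : ℝ, x ^ (b - 1) * Real.exp (-(p * x)) *
      (Real.cos (τ * u) * Real.exp (-(x * Real.cosh u))) := by
    rw [← integral_const_mul]
    refine integral_congr_ae (Filter.Eventually.of_forall fun x => ?_)
    simp only
    rw [integral_const_mul, macdonaldK_eq_integral]
    ring
  have hR : ∀ u : ℝ, ∫ x in Set.Ioi (0 : ℝ), x ^ (b - 1) * Real.exp (-(p * x)) *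
      (Real.cos (τ * u) * Real.exp (-(x * Real.cosh u))) =
      Real.Gamma b * (Real.cos (τ * u) * (p + Real.cosh u) ^ (-b)) := fun u => by
    have h1 := Real.integral_rpow_mul_exp_neg_mul_Ioi hb (hpos u)
    rw [one_div, Real.inv_rpow (hpos u).le, ← Real.rpow_neg (hpos u).le] at h1
    rw [show Real.Gamma b * (Real.cos (τ * u) * (p + Real.cosh u) ^ (-b)) =
      Real.cos (τ * u) * ((p + Real.cosh u) ^ (-b) * Real.Gamma b) by ring, ← h1,
      ← integral_const_mul]
    refine integral_congr_ae (Filter.Eventually.of_forall fun x => ?_)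
    simp only
    rw [show -((p + Real.cosh u) * x) = -(p * x) + -(x * Real.cosh u) by ring, Real.exp_add]
    ring
  rw [hL, hsw]
  simp_rw [hR]
  rw [integral_const_mul]
  ring

/-- The Mellin transform of `e^{-x} K_{iτ}(x)`. -/
lemma integral_rpow_mul_exp_neg_mul_macdonaldK {a : ℝ} (ha : 0 < a) (τ : ℝ) :
    ∫ x in Set.Ioi (0 : ℝ), x ^ (a - 1) * Real.exp (-x) * macdonaldK τ x =
      Real.Gamma a * 2 ^ (a - 1) / Real.Gamma (2 * a) * gammaSq a τ := by
  have h := integral_rpow_mul_macdonaldK ha zero_le_one τ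
  simp only [one_mul] at h
  rw [h, mul_comm_div]
  have h2 : ∀ u : ℝ, Real.cos (τ * u) * (1 + Real.cosh u) ^ (-a) =
      2 ^ a * (Real.cos (τ * u) * (2 + 2 * Real.cosh u) ^ (-a)) := fun u => by
    have hc := Real.cosh_pos u
    rw [show 2 + 2 * Real.cosh u = 2 * (1 + Real.cosh u) by ring, Real.mul_rpow (by norm_num)
      (by positivity), Real.rpow_neg (by norm_num : (0 : ℝ) ≤ 2)]
    field_simp
  simp_rw [h2]
  rw [integral_const_mul, integral_cos_mul_cosh_rpow ha, Real.rpow_sub_one two_ne_zero]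
  ring

/-- The Laplace transform of `K_{iτ}`. -/
lemma sinh_mul_integral_exp_neg_mul_macdonaldK {s : ℝ} (hs : 0 < s) (τ : ℝ) :
    Real.sinh (Real.pi * τ) *
      ∫ x in Set.Ioi (0 : ℝ), Real.exp (-(Real.cosh s * x)) * macdonaldK τ x =
      Real.pi * Real.sin (s * τ) / Real.sinh s := by
  have h := integral_rpow_mul_macdonaldK one_pos (Real.cosh_pos s).le τ
  simp only [sub_self, Real.rpow_zero, one_mul, Real.Gamma_one, Real.rpow_neg_one] at h
  rw [h, mul_left_comm, sinh_mul_integral_cos_div hs]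
  ring

/-! ### Uniqueness for the Laplace transform and Kontorovich-Lebedev inversion -/

/-- An integrable function on `(0, ∞)` is determined almost everywhere by the values of its
Laplace transform at the integers `n ≥ 2`. -/
lemma ae_eq_zero_of_laplace_eq_zero {g : ℝ → ℝ} (hg : IntegrableOn g (Set.Ioi 0))
    (h : ∀ n : ℕ, ∫ y in Set.Ioi (0 : ℝ), Real.exp (-((n + 2) * y)) * g y = 0) :
    ∀ᵐ x ∂(volume.restrict (Set.Ioi (0 : ℝ))), g x = 0 := by
  rw [ae_restrict_iff' measurableSet_Ioi]
  refine isOpen_Ioi.ae_eq_zero_of_integral_contDiff_smul_eq_zero hg.locallyIntegrableOn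
    fun ψ hψ hsupp hsub => ?_
  have hψ0 : ∀ y ≤ 0, ψ y = 0 := fun y hy =>
    image_eq_zero_of_notMem_tsupport fun hmem => absurd (hsub hmem) (by simpa using hy)
  obtain ⟨R, hR⟩ : ∃ R : ℝ, ∀ y, R < y → ψ y = 0 := by
    obtain ⟨R, hR⟩ := hsupp.isCompact.isBounded.bddAbove
    exact ⟨R, fun y hy => image_eq_zero_of_notMem_tsupport fun hmem => absurd (hR hmem) (by simpa using hy)⟩
  -- With `t = e^(-y)` the test function is `ψ(y) = t² φ(t)`. A Weierstrass polynomial `P` near `φ`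
  -- then makes `ψ` close to `e^(-2y) P(e^(-y))`, and the hypothesis annihilates `g` against the
  -- latter. Dividing by `t²` matches the exponents `n + 2`.
  set φ : ℝ → ℝ := fun t => ψ (-Real.log t) / t ^ 2 with hφ
  have hφc : ContinuousOn φ (Set.Icc 0 1) := by
    intro t ht
    rcases ht.1.eq_or_lt with rfl | ht0
    -- Near `t = 0` the argument `-log t` lies beyond the support of `ψ`, so `φ` vanishes there; at
    -- `t = 0` itself division by zero gives the value 0.
    · have : φ =ᶠ[nhdsWithin 0 (Set.Icc 0 1)] fun _ => 0 := by
        filter_upwards [self_mem_nhdsWithin, nhdsWithin_le_nhds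
          (Iio_mem_nhds (Real.exp_pos (-R)))] with t ht ht2
        rcases ht.1.eq_or_lt with rfl | ht0
        · simp [hφ]
        · have := (Real.log_lt_iff_lt_exp ht0).mpr ht2
          simp only [hφ]
          rw [hR _ (by linarith), zero_div]
      exact (continuousWithinAt_const.congr_of_eventuallyEq this (by simp [hφ]))
    · exact ((hψ.continuous.continuousAt.comp (Real.continuousAt_log ht0.ne').neg).div
        (by fun_prop) (by positivity)).continuousWithinAt
  have hexp : ∀ n : ℕ, IntegrableOn (fun y => Real.exp (-((n + 2) * y)) * g y) (Set.Ioi 0) :=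
    fun n => by
      refine hg.norm.mono' ((Continuous.aestronglyMeasurable (by fun_prop)).mul
        hg.aestronglyMeasurable) ?_
      filter_upwards [ae_restrict_mem measurableSet_Ioi] with y hy
      simp only [Set.mem_Ioi] at hy
      rw [norm_mul, Real.norm_of_nonneg (Real.exp_pos _).le]
      exact mul_le_of_le_one_left (norm_nonneg _) (Real.exp_le_one_iff.mpr (by
        have : 0 ≤ ((n : ℝ) + 2) * y := by positivity
        linarith))
  have hpoly : ∀ P : Polynomial ℝ, IntegrableOn
      (fun y => Real.exp (-(2 * y)) * P.eval (Real.exp (-y)) * g y) (Set.Ioi 0) ∧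
      ∫ y in Set.Ioi (0 : ℝ), Real.exp (-(2 * y)) * P.eval (Real.exp (-y)) * g y = 0 := fun P => by
    have heq : (fun y => Real.exp (-(2 * y)) * P.eval (Real.exp (-y)) * g y) = fun y =>
        ∑ i ∈ Finset.range (P.natDegree + 1), P.coeff i * (Real.exp (-((i + 2) * y)) * g y) := by
      ext y
      rw [Polynomial.eval_eq_sum_range, Finset.mul_sum, Finset.sum_mul]
      refine Finset.sum_congr rfl fun i _ => ?_
      rw [← Real.exp_nat_mul, show -(((i : ℝ) + 2) * y) = -(2 * y) + i * -y by ring, Real.exp_add]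
      ring
    rw [heq]
    refine ⟨integrable_finsetSum _ fun i _ => (hexp i).const_mul _, ?_⟩
    rw [integral_finsetSum _ fun i _ => (hexp i).const_mul _]
    refine Finset.sum_eq_zero fun i _ => ?_
    rw [integral_const_mul, h, mul_zero]
  have hrestr : ∫ y, ψ y • g y = ∫ y in Set.Ioi (0 : ℝ), ψ y * g y := by
    symm
    refine setIntegral_eq_integral_of_forall_compl_eq_zero fun y hy => ?_
    rw [hψ0 y (by simpa using hy), zero_mul]
  rw [hrestr]
  have hψi : IntegrableOn (fun y => ψ y * g y) (Set.Ioi 0) := by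
    obtain ⟨C, hC⟩ := hψ.continuous.bounded_above_of_compact_support hsupp
    exact hg.bdd_mul hψ.continuous.aestronglyMeasurable (Filter.Eventually.of_forall hC)
  have hbound : ∀ ε : ℝ, 0 < ε → |∫ y in Set.Ioi (0 : ℝ), ψ y * g y| ≤
      ε * ∫ y in Set.Ioi (0 : ℝ), ‖g y‖ := fun ε hε => by
    obtain ⟨P, hP⟩ := exists_polynomial_near_of_continuousOn 0 1 φ hφc ε hε
    have hsub := integral_sub hψi (hpoly P).1
    rw [(hpoly P).2, sub_zero] at hsub
    rw [← hsub, ← Real.norm_eq_abs, ← integral_const_mul]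
    refine norm_integral_le_of_norm_le (hg.norm.const_mul ε) ?_
    filter_upwards [ae_restrict_mem measurableSet_Ioi] with y hy
    simp only [Set.mem_Ioi] at hy
    have h1 : ψ y = Real.exp (-(2 * y)) * φ (Real.exp (-y)) := by
      simp only [hφ, Real.log_exp, neg_neg]
      rw [← Real.exp_nat_mul, show ((2 : ℕ) : ℝ) * -y = -(2 * y) by push_cast; ring]
      field_simp
    have h2 := hP (Real.exp (-y)) ⟨(Real.exp_pos _).le, Real.exp_le_one_iff.mpr (by linarith)⟩
    have h3 : Real.exp (-(2 * y)) ≤ 1 := Real.exp_le_one_iff.mpr (by linarith)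
    rw [h1, ← sub_mul, ← mul_sub, norm_mul, norm_mul, Real.norm_of_nonneg (Real.exp_pos _).le,
      norm_sub_rev, Real.norm_eq_abs (_ - _)]
    gcongr
    calc _ ≤ 1 * ε := by gcongr
      _ = ε := one_mul ε
  have : |∫ y in Set.Ioi (0 : ℝ), ψ y * g y| ≤ 0 := by
    refine le_of_forall_pos_le_add fun δ hδ => ?_
    have hN : 0 ≤ ∫ y in Set.Ioi (0 : ℝ), ‖g y‖ := integral_nonneg fun y => norm_nonneg _
    refine (hbound (δ / ((∫ y in Set.Ioi (0 : ℝ), ‖g y‖) + 1)) (by positivity)).trans ?_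
    rw [zero_add, div_mul_eq_mul_div, div_le_iff₀ (by positivity)]
    nlinarith
  exact abs_nonpos_iff.mp this

lemma abs_sinh_le_exp_abs (y : ℝ) : |Real.sinh y| ≤ Real.exp |y| := by
  rw [Real.abs_sinh, Real.sinh_eq]
  have := Real.exp_pos (-|y|)
  have := Real.exp_pos |y|
  linarith

lemma exists_abs_mul_sinh_mul_gammaSq_le {a : ℝ} (ha : 0 < a) :
    ∃ C, 0 ≤ C ∧ ∀ τ, |τ * Real.sinh (Real.pi * τ) * gammaSq a τ| ≤
      C * Real.exp (3 * Real.pi / 16 * |τ|) := by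
  obtain ⟨C, hC, hle⟩ := exists_abs_mul_gammaSq_le ha
  refine ⟨C, hC, fun τ => ?_⟩
  have h1 := abs_sinh_le_exp_abs (Real.pi * τ)
  rw [abs_mul Real.pi, abs_of_pos Real.pi_pos] at h1
  calc _ = (|τ| * gammaSq a τ) * |Real.sinh (Real.pi * τ)| := by
        rw [abs_mul, abs_mul, abs_of_nonneg (gammaSq_nonneg a τ)]; ring
    _ ≤ (C * Real.exp (-(13 * Real.pi / 16 * |τ|))) * Real.exp (Real.pi * |τ|) :=
        mul_le_mul (hle τ) h1 (abs_nonneg _) (by positivity)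
    _ = _ := by rw [mul_assoc, ← Real.exp_add]; congr 2; ring

/-- In `τ` the growth `3π/16` of the Gamma factor is beaten by the decay `π/4` of `K_{iτ}`, with
`π/16` to spare. In `x` the bound with `ε = b/2` leaves `x^(b/2-1) e^(-x/4)`. This licenses every
later exchange of the `x` and `τ` integrals. -/
lemma integrable_prod_macdonaldK_mul_gammaSq {a b p : ℝ} (ha : 0 < a) (hb : 0 < b) (hp : 0 ≤ p) :
    Integrable (Function.uncurry fun x τ : ℝ => x ^ (b - 1) * Real.exp (-(p * x)) *
      macdonaldK τ x * (τ * Real.sinh (Real.pi * τ) * gammaSq a τ))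
      ((volume.restrict (Set.Ioi 0)).prod (volume.restrict (Set.Ioi 0))) := by
  have hπ := Real.pi_pos
  have hb2 := half_pos hb
  obtain ⟨C, hC, hA⟩ := exists_abs_mul_sinh_mul_gammaSq_le ha
  obtain ⟨D, hD, hK⟩ := exists_abs_macdonaldK_le hb2
  have hcA := continuous_gammaSq ha
  have hKm : StronglyMeasurable fun q : ℝ × ℝ => macdonaldK q.2 q.1 :=
    stronglyMeasurable_macdonaldK.comp_measurable measurable_swap
  have hE : IntegrableOn (fun τ : ℝ => Real.exp (-(Real.pi / 16 * |τ|))) (Set.Ioi 0) :=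
    (integrable_exp_neg_mul_abs (by positivity)).integrableOn
  have hB := ((integrableOn_rpow_mul_exp_neg_mul hb2
    (show (0 : ℝ) < 1 / 4 by norm_num)).const_mul (D * C)).mul_prod hE
  refine hB.mono' (((Measurable.aestronglyMeasurable (by fun_prop)).mul
    hKm.aestronglyMeasurable).mul (Continuous.aestronglyMeasurable (by fun_prop))) ?_
  have : ∀ᵐ q : ℝ × ℝ ∂((volume.restrict (Set.Ioi 0)).prod (volume.restrict (Set.Ioi 0))),
      q.1 ∈ Set.Ioi (0 : ℝ) := by
    rw [Measure.ae_prod_iff_ae_ae (measurableSet_Ioi.preimage measurable_fst)]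
    filter_upwards [ae_restrict_mem measurableSet_Ioi] with x hx
    exact Filter.Eventually.of_forall fun _ => hx
  filter_upwards [this] with q hq
  obtain ⟨x, τ⟩ := q
  simp only [Set.mem_Ioi] at hq
  simp only [Function.uncurry]
  have h1 : Real.exp (-(p * x)) ≤ 1 := Real.exp_le_one_iff.mpr (by nlinarith)
  rw [norm_mul, norm_mul, Real.norm_eq_abs (macdonaldK τ x), Real.norm_eq_abs (_ * gammaSq a τ),
    Real.norm_of_nonneg (by positivity)]
  calc _ ≤ x ^ (b - 1) * 1 * (D * Real.exp (-(Real.pi / 4 * |τ|)) *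
        (x ^ (-(b / 2)) * Real.exp (-(x / 4)))) * (C * Real.exp (3 * Real.pi / 16 * |τ|)) := by
        gcongr
        · exact hK τ x hq
        · exact hA τ
    _ = D * C * ((x ^ (b - 1) * x ^ (-(b / 2))) * Real.exp (-(1 / 4 * x))) *
        (Real.exp (-(Real.pi / 4 * |τ|)) * Real.exp (3 * Real.pi / 16 * |τ|)) := by ring_nf
    _ = _ := by
        rw [← Real.rpow_add hq, ← Real.exp_add, show b - 1 + -(b / 2) = b / 2 - 1 by ring,
          show -(Real.pi / 4 * |τ|) + 3 * Real.pi / 16 * |τ| = -(Real.pi / 16 * |τ|) by ring]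

lemma integral_Ioi_mul_sin_mul_gammaSq {a : ℝ} (ha : 0 < a) (s : ℝ) :
    ∫ τ in Set.Ioi (0 : ℝ), τ * Real.sin (s * τ) * gammaSq a τ =
      2 * Real.pi * a * Real.Gamma (2 * a) * Real.sinh s * (2 + 2 * Real.cosh s) ^ (-a - 1) := by
  have h := integral_comp_abs (f := fun τ => τ * Real.sin (s * τ) * gammaSq a τ)
  have h2 : ∀ τ : ℝ, |τ| * Real.sin (s * |τ|) * gammaSq a |τ| =
      τ * Real.sin (s * τ) * gammaSq a τ := fun τ => by
    rcases abs_choice τ with h | h <;> rw [h]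
    rw [gammaSq_neg, mul_neg, Real.sin_neg]; ring
  simp_rw [h2] at h
  rw [integral_mul_sin_mul_gammaSq ha] at h
  linarith

/-- The Kontorovich-Lebedev inversion formula for `x^{a-1} e^{-x}`. -/
lemma ae_integral_mul_macdonaldK_eq {a : ℝ} (ha : 0 < a) :
    ∀ᵐ x ∂(volume.restrict (Set.Ioi (0 : ℝ))),
      ∫ τ in Set.Ioi (0 : ℝ), macdonaldK τ x * (τ * Real.sinh (Real.pi * τ) * gammaSq a τ) =
      Real.pi ^ 2 * 2 ^ (-a) * Real.Gamma (2 * a) / Real.Gamma a * (x ^ a * Real.exp (-x)) := by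
  have hGa := Real.Gamma_pos_of_pos ha
  set G : ℝ → ℝ := fun x =>
    ∫ τ in Set.Ioi (0 : ℝ), macdonaldK τ x * (τ * Real.sinh (Real.pi * τ) * gammaSq a τ) with hG
  set c := Real.pi ^ 2 * 2 ^ (-a) * Real.Gamma (2 * a) / Real.Gamma a with hc
  have hGi : IntegrableOn G (Set.Ioi 0) := by
    have := (integrable_prod_macdonaldK_mul_gammaSq ha one_pos le_rfl).integral_prod_left
    simpa [Function.uncurry, IntegrableOn, hG] using this
  have hti : ∀ p : ℝ, 0 ≤ p → IntegrableOn
      (fun x : ℝ => Real.exp (-(p * x)) * (c * (x ^ a * Real.exp (-x)))) (Set.Ioi 0) ∧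
      ∫ x in Set.Ioi (0 : ℝ), Real.exp (-(p * x)) * (c * (x ^ a * Real.exp (-x))) =
        c * ((1 + p) ^ (-a - 1) * (a * Real.Gamma a)) := fun p hp => by
    have hp1 : 0 < 1 + p := by linarith
    have heq : (fun x : ℝ => Real.exp (-(p * x)) * (c * (x ^ a * Real.exp (-x)))) =
        fun x => c * (x ^ (a + 1 - 1) * Real.exp (-((1 + p) * x))) := by
      ext x
      rw [show -((1 + p) * x) = -(p * x) + -x by ring, Real.exp_add, add_sub_cancel_right]
      ring
    rw [heq]
    refine ⟨(integrableOn_rpow_mul_exp_neg_mul (by linarith) hp1).const_mul c, ?_⟩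
    rw [integral_const_mul, Real.integral_rpow_mul_exp_neg_mul_Ioi (by linarith) hp1,
      Real.Gamma_add_one ha.ne', one_div, Real.inv_rpow hp1.le, ← Real.rpow_neg hp1.le, neg_add']
  have hti0 : IntegrableOn (fun x : ℝ => c * (x ^ a * Real.exp (-x))) (Set.Ioi 0) := by
    simpa using (hti 0 le_rfl).1
  have key := ae_eq_zero_of_laplace_eq_zero (g := fun x => G x - c * (x ^ a * Real.exp (-x)))
    (hGi.sub hti0) (fun n => by
      -- Since `p > 1`, it can be written as `cosh s` with `s > 0`, the form in which the Laplace
      -- transform of `K_{iτ}` is known.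
      set p : ℝ := n + 2 with hp
      have hp1 : 1 < p := by have : (0 : ℝ) ≤ n := n.cast_nonneg; linarith
      set s := Real.arcosh p with hs
      have hcs : Real.cosh s = p := Real.cosh_arcosh hp1.le
      have hs0 : 0 < s := Real.arcosh_pos hp1
      have hss : 0 < Real.sinh s := Real.sinh_pos_iff.mpr hs0
      have hprod := integrable_prod_macdonaldK_mul_gammaSq ha one_pos (p := p) (by linarith)
      have hsw := integral_integral_swap hprod
      have hGp : IntegrableOn (fun x => Real.exp (-(p * x)) * G x) (Set.Ioi 0) := by
        have := hprod.integral_prod_left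
        simpa [Function.uncurry, mul_assoc, integral_const_mul, IntegrableOn, hG] using this
      have hL : ∫ x in Set.Ioi (0 : ℝ), Real.exp (-(p * x)) * G x =
          2 * Real.pi ^ 2 * a * Real.Gamma (2 * a) * (2 + 2 * p) ^ (-a - 1) := by
        simp only [sub_self, Real.rpow_zero, one_mul, mul_assoc, integral_const_mul] at hsw
        simp only [hG, mul_assoc]
        rw [hsw]
        -- The Laplace transform of `K_{iτ}` absorbs `sinh(πτ)`, leaving a sine transform; its value
        -- carries a factor `sinh s` that cancels the one in the denominator.
        have h1 : ∀ τ : ℝ, ∫ x in Set.Ioi (0 : ℝ), Real.exp (-(p * x)) *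
            (macdonaldK τ x * (τ * (Real.sinh (Real.pi * τ) * gammaSq a τ))) =
            Real.pi / Real.sinh s * (τ * Real.sin (s * τ) * gammaSq a τ) := fun τ => by
          have h2 := sinh_mul_integral_exp_neg_mul_macdonaldK hs0 τ
          rw [hcs] at h2
          simp_rw [← mul_assoc]
          rw [integral_mul_const, integral_mul_const, integral_mul_const]
          linear_combination (τ * gammaSq a τ) * h2
        simp_rw [h1]
        rw [integral_const_mul, integral_Ioi_mul_sin_mul_gammaSq ha, hcs]
        field_simp
      simp_rw [mul_sub]
      rw [integral_sub hGp (hti p (by linarith)).1, hL, (hti p (by linarith)).2, hc,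
        show 2 + 2 * p = 2 * (1 + p) by ring, Real.mul_rpow (by norm_num) (by linarith),
        Real.rpow_sub_one two_ne_zero]
      field_simp
      ring)
  filter_upwards [key] with x hx
  linarith

/-- The pairing of `|Γ(a + iτ)|²` with the Kontorovich-Lebedev transform of
`x^{b-1} e^{-px}`. -/
lemma integral_gammaSq_mul_integral_macdonaldK {a b p : ℝ} (ha : 0 < a) (hb : 0 < b) (hp : 0 ≤ p) :
    IntegrableOn (fun τ : ℝ => τ * Real.sinh (Real.pi * τ) * gammaSq a τ *
      ∫ x in Set.Ioi (0 : ℝ), x ^ (b - 1) * Real.exp (-(p * x)) * macdonaldK τ x) (Set.Ioi 0) ∧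
    ∫ τ in Set.Ioi (0 : ℝ), τ * Real.sinh (Real.pi * τ) * gammaSq a τ *
      ∫ x in Set.Ioi (0 : ℝ), x ^ (b - 1) * Real.exp (-(p * x)) * macdonaldK τ x =
      Real.pi ^ 2 * 2 ^ (-a) * Real.Gamma (2 * a) / Real.Gamma a *
        (Real.Gamma (a + b) * (1 + p) ^ (-(a + b))) := by
  have hp1 : 0 < 1 + p := by linarith
  have hprod := integrable_prod_macdonaldK_mul_gammaSq ha hb hp
  constructor
  · have := hprod.integral_prod_right
    simp only [Function.uncurry, integral_mul_const] at this
    refine this.congr (Filter.Eventually.of_forall fun τ => ?_)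
    simp only
    ring
  · have hsw := integral_integral_swap hprod
    simp only [integral_mul_const] at hsw
    simp_rw [mul_comm (_ * gammaSq a _)]
    rw [← hsw]
    simp_rw [mul_assoc (_ * Real.exp _), integral_const_mul]
    have h1 : ∫ x in Set.Ioi (0 : ℝ), x ^ (b - 1) * Real.exp (-(p * x)) *
        ∫ τ in Set.Ioi (0 : ℝ), macdonaldK τ x * (τ * Real.sinh (Real.pi * τ) * gammaSq a τ) =
        ∫ x in Set.Ioi (0 : ℝ), Real.pi ^ 2 * 2 ^ (-a) * Real.Gamma (2 * a) / Real.Gamma a *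
          (x ^ (a + b - 1) * Real.exp (-((1 + p) * x))) := by
      refine integral_congr_ae ?_
      filter_upwards [ae_integral_mul_macdonaldK_eq ha, ae_restrict_mem measurableSet_Ioi]
        with x hx hx0
      simp only [Set.mem_Ioi] at hx0
      rw [hx, show a + b - 1 = (b - 1) + a by ring, Real.rpow_add hx0,
        show -((1 + p) * x) = -(p * x) + -x by ring, Real.exp_add]
      ring
    rw [h1, integral_const_mul, Real.integral_rpow_mul_exp_neg_mul_Ioi (by linarith) hp1, one_div,
      Real.inv_rpow hp1.le, ← Real.rpow_neg hp1.le]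
    ring

/-! ### Laguerre coefficients and their orthogonality -/

lemma gamma_add_natCast {x : ℝ} (hx : 0 < x) (k : ℕ) :
    Real.Gamma (x + k) = Real.Gamma x * (ascPochhammer ℝ k).eval x := by
  induction k with
  | zero => simp
  | succ k ih =>
    rw [Nat.cast_add_one, ← add_assoc, Real.Gamma_add_one (by positivity), ih,
      ascPochhammer_succ_eval]
    ring

lemma choose_eq_gamma_div {α : ℝ} (hα : -1 < α) {n k : ℕ} (hk : k ≤ n) :
    Ring.choose ((n : ℝ) + α) (n - k) =
      Real.Gamma (n + α + 1) / ((n - k).factorial * Real.Gamma (α + k + 1)) := by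
  have hk0 : (0 : ℝ) ≤ k := k.cast_nonneg
  have hpos : 0 < α + k + 1 := by linarith
  have h := Ring.factorial_nsmul_multichoose_eq_ascPochhammer ((n : ℝ) + α - (n - k : ℕ) + 1) (n - k)
  rw [Polynomial.ascPochhammer_smeval_eq_eval, Nat.cast_sub hk,
    show (n : ℝ) + α - (n - k) + 1 = α + k + 1 by ring, nsmul_eq_mul] at h
  have h2 := gamma_add_natCast hpos (n - k)
  rw [Nat.cast_sub hk, show α + k + 1 + (n - k : ℝ) = n + α + 1 by ring] at h2
  rw [Ring.choose, Nat.cast_sub hk, show (n : ℝ) + α - (n - k) + 1 = α + k + 1 by ring,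
    eq_div_iff (by have := Real.Gamma_pos_of_pos hpos; positivity), h2, ← h]
  ring

/-- The coefficient of `x^k` in the Laguerre polynomial `L_n^α`. -/
noncomputable def laguerreCoeff (n : ℕ) (α : ℝ) (k : ℕ) : ℝ :=
  (-1) ^ k * Ring.choose ((n : ℝ) + α) (n - k) / k.factorial

lemma laguerreL_eq_sum (n : ℕ) (α x : ℝ) :
    laguerreL n α x = ∑ k ∈ Finset.range (n + 1), laguerreCoeff n α k * x ^ k := by
  refine Finset.sum_congr rfl fun k _ => ?_
  rw [laguerreCoeff]; ring

/-- The quotient `Γ(α+1+k+j) / Γ(α+1+k)` is a polynomial of degree `j` in `k`, and the remaining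
factor is an alternating binomial coefficient. Summing over `k` therefore gives an `n`-th finite
difference. -/
lemma laguerreCoeff_mul_gamma {α : ℝ} (hα : -1 < α) {n k : ℕ} (hk : k ≤ n) (j : ℕ) :
    laguerreCoeff n α k * Real.Gamma (α + 1 + k + j) =
      Real.Gamma (n + α + 1) / n.factorial * (-1) ^ n *
        ((-1) ^ (n - k) * n.choose k * (ascPochhammer ℝ j).eval (α + 1 + k)) := by
  have hk0 : (0 : ℝ) ≤ k := k.cast_nonneg
  have hpos : 0 < α + 1 + k := by linarith
  have hG := (Real.Gamma_pos_of_pos hpos).ne'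
  have hs : (-1 : ℝ) ^ n * (-1) ^ (n - k) = (-1) ^ k := by
    obtain ⟨d, rfl⟩ := Nat.exists_eq_add_of_le hk
    rw [Nat.add_sub_cancel_left, pow_add, mul_assoc, ← pow_add, ← two_mul, pow_mul]
    simp
  rw [laguerreCoeff, choose_eq_gamma_div hα hk, gamma_add_natCast hpos, Nat.cast_choose ℝ hk,
    show α + k + 1 = α + 1 + k by ring, ← hs]
  field_simp

/-- An `n`-th difference kills polynomials of degree below `n` and sends a monic one of degree `n`
to `n!`. -/
lemma sum_laguerreCoeff_mul_gamma {α : ℝ} (hα : -1 < α) {n j : ℕ} (hj : j ≤ n) :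
    ∑ k ∈ Finset.range (n + 1), laguerreCoeff n α k * Real.Gamma (α + 1 + k + j) =
      if j = n then (-1) ^ n * Real.Gamma (n + α + 1) else 0 := by
  have h := fwdDiff_iter_eq_sum_shift (1 : ℝ) (ascPochhammer ℝ j).eval n (α + 1)
  have h2 : ∑ k ∈ Finset.range (n + 1), laguerreCoeff n α k * Real.Gamma (α + 1 + k + j) =
      Real.Gamma (n + α + 1) / n.factorial * (-1) ^ n *
        (fwdDiff 1)^[n] (ascPochhammer ℝ j).eval (α + 1) := by
    rw [h, Finset.mul_sum]
    refine Finset.sum_congr rfl fun k hk => ?_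
    rw [laguerreCoeff_mul_gamma hα (Finset.mem_range_succ_iff.mp hk)]
    simp
  rw [h2]
  have hn : (n.factorial : ℝ) ≠ 0 := by positivity
  split_ifs with hjn
  · subst hjn
    have h3 := Polynomial.fwdDiff_iter_degree_eq_factorial (ascPochhammer ℝ j)
    rw [ascPochhammer_natDegree, (monic_ascPochhammer ℝ j).leadingCoeff] at h3
    rw [h3]
    simp
    field_simp
  · rw [Polynomial.fwdDiff_iter_eq_zero_of_degree_lt (by
      rw [ascPochhammer_natDegree]; omega)]
    simp

/-- Orthogonality of the Laguerre polynomials, in terms of their coefficients. -/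
lemma sum_sum_laguerreCoeff_mul_gamma {α : ℝ} (hα : -1 < α) (n m : ℕ) :
    ∑ k ∈ Finset.range (n + 1), ∑ j ∈ Finset.range (m + 1),
      laguerreCoeff n α k * laguerreCoeff m α j * Real.Gamma (α + 1 + k + j) =
      Real.Gamma (n + α + 1) / n.factorial * if n = m then 1 else 0 := by
  -- For `m ≤ n` the sum over `k` is done first, and only `j = n` can survive; the other case
  -- follows by exchanging the roles of the two polynomials.
  have main : ∀ n m : ℕ, m ≤ n → ∑ k ∈ Finset.range (n + 1), ∑ j ∈ Finset.range (m + 1),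
      laguerreCoeff n α k * laguerreCoeff m α j * Real.Gamma (α + 1 + k + j) =
      Real.Gamma (n + α + 1) / n.factorial * if n = m then 1 else 0 := fun n m hmn => by
    rw [Finset.sum_comm]
    have h1 : ∀ j ∈ Finset.range (m + 1), ∑ k ∈ Finset.range (n + 1),
        laguerreCoeff n α k * laguerreCoeff m α j * Real.Gamma (α + 1 + k + j) =
        laguerreCoeff m α j * if j = n then (-1) ^ n * Real.Gamma (n + α + 1) else 0 := by
      intro j hj
      rw [← sum_laguerreCoeff_mul_gamma hα ((Finset.mem_range_succ_iff.mp hj).trans hmn),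
        Finset.mul_sum]
      exact Finset.sum_congr rfl fun k _ => by ring
    rw [Finset.sum_congr rfl h1]
    split_ifs with hnm
    · subst hnm
      rw [Finset.sum_eq_single n]
      · have hs : ((-1 : ℝ) ^ n) * (-1) ^ n = 1 := by rw [← pow_add, ← two_mul, pow_mul]; simp
        simp only [if_true, laguerreCoeff, Nat.sub_self, Ring.choose_zero_right]
        linear_combination (Real.Gamma (n + α + 1) / n.factorial) * hs
      · intro j _ hjn; rw [if_neg hjn, mul_zero]
      · intro h; simp at h
    · rw [mul_zero]
      refine Finset.sum_eq_zero fun j hj => ?_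
      have := Finset.mem_range_succ_iff.mp hj
      rw [if_neg (by omega), mul_zero]
  rcases le_total m n with h | h
  · exact main n m h
  · rw [Finset.sum_comm]
    have := main m n h
    rw [show (∑ j ∈ Finset.range (m + 1), ∑ k ∈ Finset.range (n + 1),
      laguerreCoeff n α k * laguerreCoeff m α j * Real.Gamma (α + 1 + k + j)) =
      ∑ k ∈ Finset.range (m + 1), ∑ j ∈ Finset.range (n + 1),
      laguerreCoeff m α k * laguerreCoeff n α j * Real.Gamma (α + 1 + k + j) from
      Finset.sum_congr rfl fun k _ => Finset.sum_congr rfl fun j _ => by ring_nf, this]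
    rcases eq_or_ne n m with rfl | hne
    · rfl
    · rw [if_neg hne, if_neg hne.symm, mul_zero, mul_zero]

/-! ### The transforms `F_n` as finite sums, and their orthogonality -/

/-- The Mellin-Laplace transform of `K_{iτ}`. -/
noncomputable def macdonaldMoment (b p τ : ℝ) : ℝ :=
  ∫ x in Set.Ioi (0 : ℝ), x ^ (b - 1) * Real.exp (-(p * x)) * macdonaldK τ x

lemma integral_rpow_mul_macdonaldK_comp_mul {b η : ℝ} (hη : 0 < η) {μ : ℝ} (hb : 0 < b)
    (hμ : 0 ≤ μ) (τ : ℝ) :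
    IntegrableOn (fun x => x ^ (b - 1) * Real.exp (-(μ * x)) * macdonaldK τ (η * x)) (Set.Ioi 0) ∧
    ∫ x in Set.Ioi (0 : ℝ), x ^ (b - 1) * Real.exp (-(μ * x)) * macdonaldK τ (η * x) =
      η ^ (-b) * macdonaldMoment b (μ / η) τ := by
  set h : ℝ → ℝ := fun y => y ^ (b - 1) * Real.exp (-(μ / η * y)) * macdonaldK τ y with hh
  have heq : Set.EqOn (fun x => η ^ (-(b - 1)) * h (η * x))
      (fun x => x ^ (b - 1) * Real.exp (-(μ * x)) * macdonaldK τ (η * x)) (Set.Ioi 0) := by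
    intro x hx
    simp only [Set.mem_Ioi] at hx
    simp only [hh]
    rw [Real.mul_rpow hη.le hx.le, Real.rpow_neg hη.le, ← mul_assoc (μ / η),
      div_mul_cancel₀ _ hη.ne']
    field_simp
  constructor
  · refine IntegrableOn.congr_fun (Integrable.const_mul ?_ _) heq measurableSet_Ioi
    have := (integrableOn_Ioi_comp_mul_left_iff h 0 hη).mpr (by
      rw [mul_zero]; exact integrableOn_rpow_mul_macdonaldK hb (div_nonneg hμ hη.le) τ)
    exact this
  · rw [← setIntegral_congr_fun measurableSet_Ioi heq, integral_const_mul,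
      integral_comp_mul_left_Ioi h 0 hη, mul_zero, smul_eq_mul, ← mul_assoc, macdonaldMoment]
    congr 1
    rw [show -b = -(b - 1) - 1 by ring, Real.rpow_sub_one hη.ne', div_eq_mul_inv]

lemma klLaguerreIntegrand_eqOn (n : ℕ) (τ α β μ η : ℝ) :
    Set.EqOn (fun x => ∑ k ∈ Finset.range (n + 1), laguerreCoeff n α k *
      (x ^ (β + k + 1 - 1) * Real.exp (-(μ * x)) * macdonaldK τ (η * x)))
      (klLaguerreIntegrand n τ α β μ η) (Set.Ioi 0) := by
  intro x hx
  simp only [Set.mem_Ioi] at hx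
  simp only [klLaguerreIntegrand]
  rw [laguerreL_eq_sum, Finset.mul_sum, Finset.sum_mul]
  refine Finset.sum_congr rfl fun k _ => ?_
  rw [add_sub_cancel_right, Real.rpow_add_natCast hx.ne', neg_mul]
  ring

lemma klLaguerre_integrableOn_and_eq {β μ η : ℝ} (hβ : -1 < β) (hμ : 0 ≤ μ) (hη : 0 < η) (n : ℕ)
    (τ α : ℝ) :
    IntegrableOn (klLaguerreIntegrand n τ α β μ η) (Set.Ioi 0) ∧
    klLaguerre n τ α β μ η = ∑ k ∈ Finset.range (n + 1), laguerreCoeff n α k *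
      (η ^ (-(β + k + 1)) * macdonaldMoment (β + k + 1) (μ / η) τ) := by
  have hb : ∀ k : ℕ, 0 < β + k + 1 := fun k => by
    have : (0 : ℝ) ≤ k := k.cast_nonneg
    linarith
  have hi : ∀ k ∈ Finset.range (n + 1), Integrable (fun x => laguerreCoeff n α k *
      (x ^ (β + k + 1 - 1) * Real.exp (-(μ * x)) * macdonaldK τ (η * x)))
      (volume.restrict (Set.Ioi 0)) := fun k _ =>
    (integral_rpow_mul_macdonaldK_comp_mul hη (hb k) hμ τ).1.const_mul _
  have heq := klLaguerreIntegrand_eqOn n τ α β μ η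
  constructor
  · exact IntegrableOn.congr_fun (integrable_finsetSum _ hi) heq measurableSet_Ioi
  · rw [klLaguerre, ← setIntegral_congr_fun measurableSet_Ioi heq, integral_finsetSum _ hi]
    refine Finset.sum_congr rfl fun k _ => ?_
    rw [integral_const_mul, (integral_rpow_mul_macdonaldK_comp_mul hη (hb k) hμ τ).2]

lemma macdonaldMoment_one {a : ℝ} (ha : 0 < a) (τ : ℝ) :
    macdonaldMoment a 1 τ = Real.Gamma a * 2 ^ (a - 1) / Real.Gamma (2 * a) * gammaSq a τ := by
  have := integral_rpow_mul_exp_neg_mul_macdonaldK ha τ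
  simpa [macdonaldMoment] using this

/-- Legendre's duplication formula; it produces the `√π` and the half-integer shifts of the explicit
form. -/
lemma gamma_mul_two_rpow_div_gamma_two_mul {a : ℝ} (ha : 0 < a) :
    Real.Gamma a * 2 ^ (a - 1) / Real.Gamma (2 * a) = √Real.pi * 2 ^ (-a) / Real.Gamma (a + 1 / 2) := by
  have h := Real.Gamma_mul_Gamma_add_half a
  have h1 := (Real.Gamma_pos_of_pos (show 0 < 2 * a by positivity)).ne'
  have h2 := (Real.Gamma_pos_of_pos (show 0 < a + 1 / 2 by positivity)).ne'
  rw [div_eq_div_iff h1 h2]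
  have h3 : (2 : ℝ) ^ (1 - 2 * a) * 2 ^ (a - 1) = 2 ^ (-a) := by
    rw [← Real.rpow_add two_pos]; congr 1; ring
  rw [← h3]
  linear_combination (2 : ℝ) ^ (a - 1) * h

lemma klLaguerre_self {β μ : ℝ} (hβ : -1 < β) (hμ : 0 < μ) (n : ℕ) (τ α : ℝ) :
    klLaguerre n τ α β μ μ = √Real.pi / (2 * μ) ^ (β + 1) *
      ∑ k ∈ Finset.range (n + 1), laguerreCoeff n α k * ((2 * μ) ^ k)⁻¹ *
        (gammaSq (β + k + 1) τ / Real.Gamma (β + k + 3 / 2)) := by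
  rw [(klLaguerre_integrableOn_and_eq hβ hμ.le hμ n τ α).2, Finset.mul_sum]
  refine Finset.sum_congr rfl fun k _ => ?_
  have hb : 0 < β + k + 1 := by
    have : (0 : ℝ) ≤ k := k.cast_nonneg
    linarith
  rw [div_self hμ.ne', macdonaldMoment_one hb, gamma_mul_two_rpow_div_gamma_two_mul hb,
    show β + k + 1 + 1 / 2 = β + k + 3 / 2 by ring]
  have h : μ ^ (-(β + k + 1)) * 2 ^ (-(β + k + 1)) = ((2 * μ) ^ (β + 1))⁻¹ * ((2 * μ) ^ k)⁻¹ := by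
    rw [mul_comm, ← Real.mul_rpow two_pos.le hμ.le, Real.rpow_neg (by positivity), ← mul_inv,
      ← Real.rpow_add_natCast (by positivity)]
    congr 2
    ring
  linear_combination (laguerreCoeff n α k * √Real.pi / Real.Gamma (β + k + 3 / 2) *
    gammaSq (β + k + 1) τ) * h

/-- Orthogonality of the Kontorovich-Lebedev images of Laguerre functions. -/
lemma integral_klLaguerre_mul_klLaguerre {β γ μ : ℝ} (hβ : -1 < β) (hγ : -1 < γ) (hμ : 0 < μ)
    (hμ1 : μ ≤ 1) (n m : ℕ) :
    IntegrableOn (fun τ : ℝ => τ * Real.sinh (Real.pi * τ) *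
      klLaguerre n τ (β + γ + 1) β μ μ * klLaguerre m τ (β + γ + 1) γ (1 - μ) μ) (Set.Ioi 0) ∧
    ∫ τ in Set.Ioi (0 : ℝ), τ * Real.sinh (Real.pi * τ) *
        klLaguerre n τ (β + γ + 1) β μ μ * klLaguerre m τ (β + γ + 1) γ (1 - μ) μ =
      Real.pi ^ 2 / (2 * (n.factorial : ℝ)) * Real.Gamma (n + (β + γ + 1) + 1) *
        (if n = m then 1 else 0) := by
  set α := β + γ + 1 with hα
  set p := (1 - μ) / μ with hp
  have hp0 : 0 ≤ p := div_nonneg (by linarith) hμ.le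
  -- After scaling, the second factor has Laplace parameter `p = (1-μ)/μ`, so the pairing
  -- contributes `(1+p)^(-(α+1+k+j)) = μ^(α+1+k+j)`. By `α = β+γ+1` this cancels the powers of `μ`
  -- coming from the scaling.
  have hp1 : 1 + p = μ⁻¹ := by rw [hp]; field_simp; ring
  have hb : ∀ k : ℕ, 0 < β + k + 1 := fun k => by
    have : (0 : ℝ) ≤ k := k.cast_nonneg
    linarith
  have hc : ∀ k : ℕ, 0 < γ + k + 1 := fun k => by
    have : (0 : ℝ) ≤ k := k.cast_nonneg
    linarith
  set d : ℕ → ℕ → ℝ := fun k j => laguerreCoeff n α k * laguerreCoeff m α j *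
    (μ ^ (-(β + k + 1)) * μ ^ (-(γ + j + 1)) *
      (Real.Gamma (β + k + 1) * 2 ^ (β + k + 1 - 1) / Real.Gamma (2 * (β + k + 1)))) with hd
  have heq : (fun τ : ℝ => τ * Real.sinh (Real.pi * τ) *
      klLaguerre n τ α β μ μ * klLaguerre m τ α γ (1 - μ) μ) = fun τ =>
      ∑ k ∈ Finset.range (n + 1), ∑ j ∈ Finset.range (m + 1), d k j *
        (τ * Real.sinh (Real.pi * τ) * gammaSq (β + k + 1) τ *
          ∫ x in Set.Ioi (0 : ℝ), x ^ (γ + j + 1 - 1) * Real.exp (-(p * x)) * macdonaldK τ x) := by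
    ext τ
    rw [(klLaguerre_integrableOn_and_eq hβ hμ.le hμ n τ α).2,
      (klLaguerre_integrableOn_and_eq hγ (by linarith) hμ m τ α).2, mul_assoc,
      Finset.sum_mul_sum, Finset.mul_sum]
    refine Finset.sum_congr rfl fun k _ => ?_
    rw [Finset.mul_sum]
    refine Finset.sum_congr rfl fun j _ => ?_
    rw [div_self hμ.ne', macdonaldMoment_one (hb k), macdonaldMoment, hd]
    ring
  have hint : ∀ k j : ℕ, Integrable (fun τ : ℝ => d k j *
      (τ * Real.sinh (Real.pi * τ) * gammaSq (β + k + 1) τ *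
        ∫ x in Set.Ioi (0 : ℝ), x ^ (γ + j + 1 - 1) * Real.exp (-(p * x)) * macdonaldK τ x))
      (volume.restrict (Set.Ioi 0)) := fun k j =>
    (integral_gammaSq_mul_integral_macdonaldK (hb k) (hc j) hp0).1.const_mul _
  rw [heq]
  refine ⟨integrable_finsetSum _ fun k _ => integrable_finsetSum _ fun j _ => hint k j, ?_⟩
  rw [integral_finsetSum _ fun k _ => integrable_finsetSum _ fun j _ => hint k j]
  have hval : ∀ k j : ℕ, ∫ τ in Set.Ioi (0 : ℝ), d k j *
      (τ * Real.sinh (Real.pi * τ) * gammaSq (β + k + 1) τ *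
        ∫ x in Set.Ioi (0 : ℝ), x ^ (γ + j + 1 - 1) * Real.exp (-(p * x)) * macdonaldK τ x) =
      Real.pi ^ 2 / 2 * (laguerreCoeff n α k * laguerreCoeff m α j *
        Real.Gamma (α + 1 + k + j)) := fun k j => by
    rw [integral_const_mul, (integral_gammaSq_mul_integral_macdonaldK (hb k) (hc j) hp0).2, hp1,
      Real.inv_rpow hμ.le, Real.rpow_neg hμ.le, inv_inv,
      show β + k + 1 + (γ + j + 1) = α + 1 + k + j by rw [hα]; ring]
    have h1 : μ ^ (-(β + k + 1)) * μ ^ (-(γ + j + 1)) * μ ^ (α + 1 + k + j) = 1 := by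
      rw [← Real.rpow_add hμ, ← Real.rpow_add hμ, hα]
      convert! Real.rpow_zero μ using 2
      ring
    have h2 : (2 : ℝ) ^ (β + k + 1 - 1) * 2 ^ (-(β + k + 1)) = 1 / 2 := by
      rw [← Real.rpow_add two_pos, show β + k + 1 - 1 + -(β + k + 1) = -1 by ring,
        Real.rpow_neg_one, one_div]
    have hG1 := (Real.Gamma_pos_of_pos (hb k)).ne'
    have hG2 := (Real.Gamma_pos_of_pos (show 0 < 2 * (β + k + 1) by linarith [hb k])).ne'
    calc _ = laguerreCoeff n α k * laguerreCoeff m α j * Real.Gamma (α + 1 + k + j) *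
          Real.pi ^ 2 * (μ ^ (-(β + k + 1)) * μ ^ (-(γ + j + 1)) * μ ^ (α + 1 + k + j)) *
          ((2 : ℝ) ^ (β + k + 1 - 1) * 2 ^ (-(β + k + 1))) *
          (Real.Gamma (β + k + 1) / Real.Gamma (β + k + 1)) *
          (Real.Gamma (2 * (β + k + 1)) / Real.Gamma (2 * (β + k + 1))) := by
          rw [hd]; ring
      _ = _ := by rw [h1, h2, div_self hG1, div_self hG2]; ring
  have hsum : ∀ k ∈ Finset.range (n + 1), ∫ τ in Set.Ioi (0 : ℝ),
      ∑ j ∈ Finset.range (m + 1), d k j *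
        (τ * Real.sinh (Real.pi * τ) * gammaSq (β + k + 1) τ *
          ∫ x in Set.Ioi (0 : ℝ), x ^ (γ + j + 1 - 1) * Real.exp (-(p * x)) * macdonaldK τ x) =
      Real.pi ^ 2 / 2 * ∑ j ∈ Finset.range (m + 1), laguerreCoeff n α k * laguerreCoeff m α j *
        Real.Gamma (α + 1 + k + j) := fun k _ => by
    rw [integral_finsetSum _ fun j _ => hint k j, Finset.mul_sum]
    exact Finset.sum_congr rfl fun j _ => hval k j
  rw [Finset.sum_congr rfl hsum, ← Finset.mul_sum,
    sum_sum_laguerreCoeff_mul_gamma (by rw [hα]; linarith)]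
  ring

/-! ### The hypergeometric form -/

/-- `∏_{j<k} (X + (a+j)²)`, whose value at `τ²` is `(a+iτ)_k (a-iτ)_k`. -/
noncomputable def sqShiftProd (a : ℝ) (k : ℕ) : Polynomial ℝ :=
  ∏ j ∈ Finset.range k, (Polynomial.X + Polynomial.C ((a + j) ^ 2))

lemma monic_sqShiftProd (a : ℝ) (k : ℕ) : (sqShiftProd a k).Monic :=
  Polynomial.monic_prod_of_monic _ _ fun _ _ => Polynomial.monic_X_add_C _

lemma natDegree_sqShiftProd (a : ℝ) (k : ℕ) : (sqShiftProd a k).natDegree = k := by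
  rw [sqShiftProd, Polynomial.natDegree_prod_of_monic _ _ fun _ _ => Polynomial.monic_X_add_C _]
  simp only [Polynomial.natDegree_X_add_C]
  simp

lemma poch_mul_poch_eq_sqShiftProd (a τ : ℝ) (k : ℕ) :
    poch (a + Complex.I * τ) k * poch (a - Complex.I * τ) k =
      (((sqShiftProd a k).eval (τ ^ 2) : ℝ) : ℂ) := by
  induction k with
  | zero => simp [poch, sqShiftProd]
  | succ k ih =>
    simp only [poch] at ih ⊢
    rw [ascPochhammer_succ_eval, ascPochhammer_succ_eval, sqShiftProd, Finset.prod_range_succ,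
      Polynomial.eval_mul, ← sqShiftProd, Complex.ofReal_mul, ← ih]
    simp only [Polynomial.eval_add, Polynomial.eval_X, Polynomial.eval_C]
    push_cast
    linear_combination -((ascPochhammer ℂ k).eval (a + Complex.I * τ) *
      (ascPochhammer ℂ k).eval (a - Complex.I * τ)) * (τ : ℂ) ^ 2 * Complex.I_sq

lemma gammaSq_add_natCast {a : ℝ} (ha : 0 < a) (τ : ℝ) (k : ℕ) :
    gammaSq (a + k) τ = gammaSq a τ * (sqShiftProd a k).eval (τ ^ 2) := by
  induction k with
  | zero => simp [sqShiftProd]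
  | succ k ih =>
    rw [Nat.cast_add_one, ← add_assoc, gammaSq_add_one (Or.inl (by positivity)), ih, sqShiftProd,
      sqShiftProd, Finset.prod_range_succ, Polynomial.eval_mul]
    simp only [Polynomial.eval_add, Polynomial.eval_X, Polynomial.eval_C]
    ring

lemma poch_ofReal (x : ℝ) (k : ℕ) : poch (x : ℂ) k = (((ascPochhammer ℝ k).eval x : ℝ) : ℂ) := by
  induction k with
  | zero => simp [poch]
  | succ k ih =>
    simp only [poch] at ih ⊢
    rw [ascPochhammer_succ_eval, ascPochhammer_succ_eval, ih]
    push_cast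
    rfl

/-- The coefficient of `(a+iτ)_k (a-iτ)_k` in `₃F₂(-n, a+iτ, a-iτ; c, d; z)`. -/
noncomputable def hypCoeff (n : ℕ) (c d z : ℝ) (k : ℕ) : ℝ :=
  (ascPochhammer ℝ k).eval (-(n : ℝ)) /
    ((ascPochhammer ℝ k).eval c * (ascPochhammer ℝ k).eval d) * (z ^ k / k.factorial)

/-- `₃F₂(-n, a+iτ, a-iτ; c, d; z)` as a polynomial in `τ²`. -/
noncomputable def hypPoly (n : ℕ) (a c d z : ℝ) : Polynomial ℝ :=
  ∑ k ∈ Finset.range (n + 1), Polynomial.C (hypCoeff n c d z k) * sqShiftProd a k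

/-- The series terminates because `(-n)_k = 0` for `k > n`, and `(a+iτ)_k (a-iτ)_k` is a real
polynomial in `τ²`. -/
lemma hyp3F2_eq_eval_hypPoly (n : ℕ) (a c d z τ : ℝ) :
    hyp3F2 (-(n : ℂ)) (a + Complex.I * τ) (a - Complex.I * τ) c d z =
      (((hypPoly n a c d z).eval (τ ^ 2) : ℝ) : ℂ) := by
  have hn : (-(n : ℂ)) = ((-(n : ℝ) : ℝ) : ℂ) := by push_cast; rfl
  rw [hyp3F2, tsum_eq_sum (s := Finset.range (n + 1)), hypPoly, Polynomial.eval_finsetSum,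
    Complex.ofReal_sum]
  · refine Finset.sum_congr rfl fun k _ => ?_
    rw [mul_assoc (poch _ k), poch_mul_poch_eq_sqShiftProd, hn, poch_ofReal, poch_ofReal,
      poch_ofReal, Polynomial.eval_mul, Polynomial.eval_C, hypCoeff]
    push_cast
    ring
  · intro k hk
    have hk' : n < k := by simpa using hk
    rw [hn, poch_ofReal, ascPochhammer_eval_neg_coe_nat_of_lt hk']
    simp

lemma ascPochhammer_eval_neg_natCast {n k : ℕ} (hk : k ≤ n) :
    (ascPochhammer ℝ k).eval (-(n : ℝ)) = (-1) ^ k * (n.factorial / (n - k).factorial) := by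
  rw [ascPochhammer_eval_neg_eq_descPochhammer, descPochhammer_eval_eq_descFactorial,
    ← Nat.factorial_mul_descFactorial hk]
  push_cast
  field_simp

/-- Term-by-term conversion to hypergeometric coefficients, from `(-n)_k = (-1)^k n!/(n-k)!` and the
Gamma quotients as Pochhammer symbols. -/
lemma laguerreCoeff_div_gamma {α β : ℝ} (hα : -1 < α) (hβ : -1 < β) {n k : ℕ} (hk : k ≤ n) (z : ℝ) :
    laguerreCoeff n α k * z ^ k / Real.Gamma (β + k + 3 / 2) =
      (ascPochhammer ℝ n).eval (α + 1) / (n.factorial * Real.Gamma (β + 3 / 2)) *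
        hypCoeff n (α + 1) (β + 3 / 2) z k := by
  have h1 := gamma_add_natCast (show 0 < α + 1 by linarith) n
  have h2 := gamma_add_natCast (show 0 < α + 1 by linarith) k
  have h3 := gamma_add_natCast (show 0 < β + 3 / 2 by linarith) k
  have hp1 := ascPochhammer_pos k (α + 1) (by linarith)
  have hp2 := ascPochhammer_pos k (β + 3 / 2) (by linarith)
  have hG1 := Real.Gamma_pos_of_pos (show 0 < α + 1 by linarith)
  have hG2 := Real.Gamma_pos_of_pos (show 0 < β + 3 / 2 by linarith)
  rw [laguerreCoeff, choose_eq_gamma_div hα hk, hypCoeff, ascPochhammer_eval_neg_natCast hk,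
    show (n : ℝ) + α + 1 = α + 1 + n by ring, h1, show α + k + 1 = α + 1 + k by ring, h2,
    show β + k + 3 / 2 = β + 3 / 2 + k by ring, h3]
  field_simp

lemma klLaguerre_self_eq_hypPoly {α β μ : ℝ} (hα : -1 < α) (hβ : -1 < β) (hμ : 0 < μ) (n : ℕ)
    (τ : ℝ) :
    klLaguerre n τ α β μ μ = √Real.pi / ((2 * μ) ^ (β + 1) * n.factorial) *
      (gammaSq (β + 1) τ * (ascPochhammer ℝ n).eval (α + 1) / Real.Gamma (β + 3 / 2)) *
      (hypPoly n (β + 1) (α + 1) (β + 3 / 2) (1 / (2 * μ))).eval (τ ^ 2) := by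
  rw [klLaguerre_self hβ hμ, hypPoly, Polynomial.eval_finsetSum, Finset.mul_sum, Finset.mul_sum]
  refine Finset.sum_congr rfl fun k hk => ?_
  have h := laguerreCoeff_div_gamma hα hβ (Finset.mem_range_succ_iff.mp hk) (1 / (2 * μ))
  rw [show β + k + 1 = β + 1 + k by ring, gammaSq_add_natCast (by linarith), Polynomial.eval_mul,
    Polynomial.eval_C]
  rw [one_div, inv_pow, ← one_div] at h
  calc _ = √Real.pi / (2 * μ) ^ (β + 1) * gammaSq (β + 1) τ *
        (sqShiftProd (β + 1) k).eval (τ ^ 2) *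
        (laguerreCoeff n α k * (1 / (2 * μ) ^ k) / Real.Gamma (β + k + 3 / 2)) := by ring
    _ = _ := by rw [h]; ring_nf

lemma klLaguerre_self_complex {α β μ : ℝ} (hβ : -1 < β) (hμ : 0 < μ) (n : ℕ) (τ : ℝ) :
    (klLaguerre n τ α β μ μ : ℂ) = ((√Real.pi / (2 * μ) ^ (β + 1) : ℝ) : ℂ) *
      ∑ k ∈ Finset.range (n + 1), (-1 : ℂ) ^ k / (k.factorial : ℂ) *
        ((Ring.choose ((n : ℝ) + α) (n - k) : ℝ) : ℂ) * ((2 * μ : ℂ) ^ k)⁻¹ *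
        (Complex.Gamma (β + k + 1 - Complex.I * τ) * Complex.Gamma (β + k + 1 + Complex.I * τ) /
          Complex.Gamma (β + k + 3 / 2)) := by
  rw [klLaguerre_self hβ hμ, Complex.ofReal_mul, Complex.ofReal_sum]
  congr 1
  refine Finset.sum_congr rfl fun k _ => ?_
  have h1 := gamma_mul_gamma_eq_gammaSq (β + k + 1) τ
  have h2 := Complex.Gamma_ofReal (β + k + 3 / 2)
  push_cast at h1 h2
  rw [mul_comm (Complex.Gamma _) (Complex.Gamma _), h1, h2, laguerreCoeff]
  push_cast
  ring

lemma klLaguerre_self_complex_hyp3F2 {α β μ : ℝ} (hα : -1 < α) (hβ : -1 < β) (hμ : 0 < μ) (n : ℕ)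
    (τ : ℝ) :
    (klLaguerre n τ α β μ μ : ℂ) =
      ((√Real.pi / ((2 * μ) ^ (β + 1) * (n.factorial : ℝ)) : ℝ) : ℂ) *
        (((‖Complex.Gamma (β + 1 - Complex.I * τ)‖ ^ 2 : ℝ) : ℂ) * poch (α + 1) n /
          Complex.Gamma (β + 3 / 2)) *
        hyp3F2 (-(n : ℂ)) (β + 1 + Complex.I * τ) (β + 1 - Complex.I * τ)
          (α + 1) (β + 3 / 2) (1 / (2 * μ)) := by
  have h1 := hyp3F2_eq_eval_hypPoly n (β + 1) (α + 1) (β + 3 / 2) (1 / (2 * μ)) τ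
  have h2 := norm_gamma_sub_sq (β + 1) τ
  have h3 := Complex.Gamma_ofReal (β + 3 / 2)
  have h4 := poch_ofReal (α + 1) n
  push_cast at h1 h2 h3 h4
  rw [h1, h2, h3, h4, klLaguerre_self_eq_hypPoly hα hβ hμ]
  push_cast
  ring

lemma exists_polynomial_hyp3F2_eq (α β μ : ℝ) (n : ℕ) :
    ∃ p : Polynomial ℝ, ∀ τ : ℝ,
      hyp3F2 (-(n : ℂ)) (β + 1 + Complex.I * τ) (β + 1 - Complex.I * τ)
        (α + 1) (β + 3 / 2) (1 / (2 * μ)) = ((p.eval τ : ℝ) : ℂ) := by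
  refine ⟨(hypPoly n (β + 1) (α + 1) (β + 3 / 2) (1 / (2 * μ))).comp (Polynomial.X ^ 2),
    fun τ => ?_⟩
  have h1 := hyp3F2_eq_eval_hypPoly n (β + 1) (α + 1) (β + 3 / 2) (1 / (2 * μ)) τ
  push_cast at h1
  rw [h1, Polynomial.eval_comp]
  simp

/-! ### Continuous dual Hahn polynomials with third parameter `1/2` -/

/-- The continuous dual Hahn polynomial `S_n(X; a, b, 1/2)`. -/
noncomputable def dualHahnPoly (n : ℕ) (a b : ℝ) : Polynomial ℝ :=
  Polynomial.C ((ascPochhammer ℝ n).eval (a + b) * (ascPochhammer ℝ n).eval (a + 1 / 2)) *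
    hypPoly n a (a + b) (a + 1 / 2) 1

lemma dualHahnS_eq_eval_dualHahnPoly (n : ℕ) (t a b : ℝ) :
    dualHahnS n t a b (1 / 2) = (((dualHahnPoly n a b).eval (t ^ 2) : ℝ) : ℂ) := by
  have h1 := hyp3F2_eq_eval_hypPoly n a (a + b) (a + 1 / 2) 1 t
  have h2 := poch_ofReal (a + b) n
  have h3 := poch_ofReal (a + 1 / 2) n
  push_cast at h1 h2 h3
  rw [dualHahnS, dualHahnPoly, Polynomial.eval_mul, Polynomial.eval_C]
  push_cast
  rw [h1, h2, h3]

/-- Only the term `k = n` reaches degree `n`. Its coefficient is `(-n)_n / n! = (-1)^n`, since the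
normalising Pochhammer symbols cancel the denominators. It is the same for `(a, b)` and `(b, a)`. -/
lemma degree_dualHahnPoly_sub_lt {a b : ℝ} (ha : 0 < a) (hb : 0 < b) (n : ℕ) :
    (dualHahnPoly n a b - Polynomial.C ((-1) ^ n) * Polynomial.X ^ n).degree < (n : WithBot ℕ) := by
  have hp1 := ascPochhammer_pos n (a + b) (by linarith)
  have hp2 := ascPochhammer_pos n (a + 1 / 2) (by linarith)
  have hlead : (ascPochhammer ℝ n).eval (a + b) * (ascPochhammer ℝ n).eval (a + 1 / 2) *
      hypCoeff n (a + b) (a + 1 / 2) 1 n = (-1) ^ n := by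
    rw [hypCoeff, ascPochhammer_eval_neg_natCast le_rfl]
    have : (n.factorial : ℝ) ≠ 0 := by positivity
    generalize (ascPochhammer ℝ n).eval (a + 1 / 2) = y at hp2 ⊢
    simp
    field_simp
  have h1 : dualHahnPoly n a b - Polynomial.C ((-1) ^ n) * Polynomial.X ^ n =
      Polynomial.C ((ascPochhammer ℝ n).eval (a + b) * (ascPochhammer ℝ n).eval (a + 1 / 2)) *
        (∑ k ∈ Finset.range n, Polynomial.C (hypCoeff n (a + b) (a + 1 / 2) 1 k) *
          sqShiftProd a k) +
      Polynomial.C ((-1) ^ n) * (sqShiftProd a n - Polynomial.X ^ n) := by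
    rw [dualHahnPoly, hypPoly, Finset.sum_range_succ, mul_add, ← mul_assoc, ← Polynomial.C_mul,
      hlead]
    ring
  rw [h1, ← Polynomial.mem_degreeLT]
  refine Submodule.add_mem _ ?_ ?_
  · rw [← Polynomial.smul_eq_C_mul]
    refine Submodule.smul_mem _ _ (Submodule.sum_mem _ fun k hk => ?_)
    rw [← Polynomial.smul_eq_C_mul]
    refine Submodule.smul_mem _ _ (Polynomial.mem_degreeLT.mpr ?_)
    refine Polynomial.degree_le_natDegree.trans_lt ?_
    rw [natDegree_sqShiftProd]
    exact_mod_cast Finset.mem_range.mp hk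
  · rw [← Polynomial.smul_eq_C_mul]
    refine Submodule.smul_mem _ _ (Polynomial.mem_degreeLT.mpr ?_)
    have hd : (sqShiftProd a n).degree = n := by
      rw [Polynomial.degree_eq_natDegree (monic_sqShiftProd a n).ne_zero, natDegree_sqShiftProd]
    have := Polynomial.degree_sub_lt_left (p := sqShiftProd a n) (q := Polynomial.X ^ n)
      (by rw [hd, Polynomial.degree_X_pow]) (monic_sqShiftProd a n).ne_zero
      (by rw [(monic_sqShiftProd a n).leadingCoeff, Polynomial.leadingCoeff_X_pow])
    rwa [hd] at this

/-- A triangular family of polynomials `Q_j = ± X^j + ⋯`, `j < n`, spans the polynomials of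
degree less than `n`. -/
lemma polynomial_induction_of_triangular {Q : ℕ → Polynomial ℝ}
    (hQ : ∀ j : ℕ, (Q j - Polynomial.C ((-1) ^ j) * Polynomial.X ^ j).degree < (j : WithBot ℕ))
    {p : Polynomial ℝ → Prop} (h0 : p 0) (hadd : ∀ P R, p P → p R → p (P + R))
    (hsmul : ∀ (c : ℝ) P, p P → p (Polynomial.C c * P)) (n : ℕ) (h : ∀ j < n, p (Q j))
    (P : Polynomial ℝ) (hP : P.degree < (n : WithBot ℕ)) : p P := by
  induction n generalizing P with
  | zero =>
    rwa [Polynomial.degree_eq_bot.mp (Nat.WithBot.lt_zero_iff.mp hP)]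
  | succ n ih =>
    -- As `(-1)^n` is its own inverse, subtracting `c Q_n` removes the coefficient of `X^n`.
    set c := P.coeff n * (-1) ^ n with hc
    have hs : ((-1 : ℝ) ^ n) * (-1) ^ n = 1 := by rw [← pow_add, ← two_mul, pow_mul]; simp
    have hco : ∀ m, n ≤ m → (Q n).coeff m = if m = n then (-1) ^ n else 0 := fun m hm => by
      have h1 := Polynomial.coeff_eq_zero_of_degree_lt (lt_of_lt_of_le (hQ n)
        (show (n : WithBot ℕ) ≤ m by exact_mod_cast hm))
      rw [Polynomial.coeff_sub, Polynomial.coeff_C_mul, Polynomial.coeff_X_pow] at h1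
      rw [sub_eq_zero.mp h1]
      simp
    have hdeg : (P - Polynomial.C c * Q n).degree < (n : WithBot ℕ) := by
      rw [Polynomial.degree_lt_iff_coeff_zero]
      intro m hm
      rw [Polynomial.coeff_sub, Polynomial.coeff_C_mul, hco m hm]
      split_ifs with hmn
      · subst hmn
        rw [hc, mul_assoc, hs, mul_one, sub_self]
      · rw [mul_zero, sub_zero]
        refine Polynomial.coeff_eq_zero_of_degree_lt (hP.trans_le ?_)
        exact_mod_cast Nat.lt_of_le_of_ne hm (Ne.symm hmn)
    have h1 := ih (fun j hj => h j (by omega)) _ hdeg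
    have h2 := hadd _ _ h1 (hsmul c _ (h n (by omega)))
    rwa [sub_add_cancel] at h2

/-- The weight `|Γ(a+it) Γ(b+it) / Γ(it)|²`. -/
noncomputable def dualHahnWeight (a b t : ℝ) : ℝ :=
  gammaSq a t * gammaSq b t * (t * Real.sinh (Real.pi * t) / Real.pi)

lemma norm_gamma_mul_gamma_div_gamma_sq (a b t : ℝ) :
    ‖Complex.Gamma (a + Complex.I * t) * Complex.Gamma (b + Complex.I * t) /
      Complex.Gamma (Complex.I * t)‖ ^ 2 = dualHahnWeight a b t := by
  rw [norm_div, norm_mul, div_pow, mul_pow, ← gammaSq, ← gammaSq, dualHahnWeight,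
    ← inv_gammaSq_zero, ← div_eq_mul_inv]
  simp [gammaSq]

/-- At `μ = 1/2` the hypergeometric argument `1/(2μ)` is 1, and with `a = β+1`, `b = γ+1` the lower
parameters are `a + b` and `a + 1/2`. -/
lemma klLaguerre_half {β γ : ℝ} (hβ : -1 < β) (hγ : -1 < γ) (n : ℕ) (τ : ℝ) :
    klLaguerre n τ (β + γ + 1) β (1 / 2) (1 / 2) =
      √Real.pi / (n.factorial * Real.Gamma (n + β + 3 / 2)) * gammaSq (β + 1) τ *
        (dualHahnPoly n (β + 1) (γ + 1)).eval (τ ^ 2) := by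
  have h3 := gamma_add_natCast (show 0 < β + 3 / 2 by linarith) n
  have hG2 := Real.Gamma_pos_of_pos (show 0 < β + 3 / 2 by linarith)
  have hp2 := ascPochhammer_pos n (β + 3 / 2) (by linarith)
  rw [klLaguerre_self_eq_hypPoly (by linarith) hβ (by norm_num), dualHahnPoly, Polynomial.eval_mul,
    Polynomial.eval_C, show (2 : ℝ) * (1 / 2) = 1 by norm_num, Real.one_rpow,
    show β + 1 + (γ + 1) = β + γ + 1 + 1 by ring, show β + 1 + 1 / 2 = β + 3 / 2 by ring,
    show (n : ℝ) + β + 3 / 2 = β + 3 / 2 + n by ring, h3, div_one, one_mul]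
  generalize Real.Gamma (β + 3 / 2) = g at hG2 ⊢
  generalize (ascPochhammer ℝ n).eval (β + 3 / 2) = y at hp2 ⊢
  field_simp

/-- The case `μ = 1/2` of the orthogonality of the `F_n`. The second factor has `β` and `γ`
exchanged, hence the exchanged parameters in its polynomial. -/
lemma integral_dualHahnWeight_mul_mixed {β γ : ℝ} (hβ : -1 < β) (hγ : -1 < γ) (n m : ℕ) :
    IntegrableOn (fun t => dualHahnWeight (β + 1) (γ + 1) t *
      ((dualHahnPoly n (β + 1) (γ + 1)).eval (t ^ 2) *
        (dualHahnPoly m (γ + 1) (β + 1)).eval (t ^ 2))) (Set.Ioi 0) ∧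
    ∫ t in Set.Ioi (0 : ℝ), dualHahnWeight (β + 1) (γ + 1) t *
      ((dualHahnPoly n (β + 1) (γ + 1)).eval (t ^ 2) *
        (dualHahnPoly m (γ + 1) (β + 1)).eval (t ^ 2)) =
      (n.factorial : ℝ) / 2 * (if n = m then 1 else 0) * Real.Gamma (n + β + γ + 2) *
          Real.Gamma (n + β + 3 / 2) * Real.Gamma (n + γ + 3 / 2) := by
  obtain ⟨hi, hv⟩ := integral_klLaguerre_mul_klLaguerre hβ hγ (show (0 : ℝ) < 1 / 2 by norm_num)
    (by norm_num) n m
  have hn0 : (0 : ℝ) ≤ n := n.cast_nonneg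
  have hm0 : (0 : ℝ) ≤ m := m.cast_nonneg
  have hGn := Real.Gamma_pos_of_pos (show 0 < n + β + 3 / 2 by linarith)
  have hGm := Real.Gamma_pos_of_pos (show 0 < m + γ + 3 / 2 by linarith)
  have hπ := Real.pi_pos
  -- The constant undoes the two prefactors from `klLaguerre_half`, whose product has numerator `π`,
  -- and supplies the `1/π` of the weight.
  set c := n.factorial * Real.Gamma (n + β + 3 / 2) * (m.factorial * Real.Gamma (m + γ + 3 / 2)) /
    Real.pi ^ 2 with hc
  have heq : (fun t => dualHahnWeight (β + 1) (γ + 1) t *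
      ((dualHahnPoly n (β + 1) (γ + 1)).eval (t ^ 2) *
        (dualHahnPoly m (γ + 1) (β + 1)).eval (t ^ 2))) = fun τ =>
      c * (τ * Real.sinh (Real.pi * τ) * klLaguerre n τ (β + γ + 1) β (1 / 2) (1 / 2) *
        klLaguerre m τ (β + γ + 1) γ (1 - 1 / 2) (1 / 2)) := by
    ext τ
    rw [klLaguerre_half hβ hγ, show (1 : ℝ) - 1 / 2 = 1 / 2 by norm_num,
      show β + γ + 1 = γ + β + 1 by ring, klLaguerre_half hγ hβ, hc, dualHahnWeight]
    have : (n.factorial : ℝ) ≠ 0 := by positivity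
    have : (m.factorial : ℝ) ≠ 0 := by positivity
    generalize Real.Gamma (n + β + 3 / 2) = g at hGn ⊢
    generalize Real.Gamma (m + γ + 3 / 2) = g' at hGm ⊢
    field_simp
    rw [Real.sq_sqrt hπ.le]
    ring
  rw [heq]
  refine ⟨hi.const_mul c, ?_⟩
  rw [integral_const_mul, hv, hc]
  have : (n.factorial : ℝ) ≠ 0 := by positivity
  split_ifs with hnm
  · subst hnm
    rw [show (n : ℝ) + (β + γ + 1) + 1 = n + β + γ + 2 by ring]
    field_simp
  · simp

/-- Since the polynomial of index 0 is 1, the mixed orthogonality already contains the integrability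
of the weight times each `dualHahnPoly j b a`. These span all polynomials, so no further estimate is
needed. -/
lemma integrableOn_dualHahnWeight_mul_eval {a b : ℝ} (ha : 0 < a) (hb : 0 < b)
    (P : Polynomial ℝ) :
    IntegrableOn (fun t => dualHahnWeight a b t * P.eval (t ^ 2)) (Set.Ioi 0) := by
  have h0 : ∀ t : ℝ, (dualHahnPoly 0 a b).eval (t ^ 2) = 1 := fun t => by
    simp [dualHahnPoly, hypPoly, hypCoeff, sqShiftProd]
  refine polynomial_induction_of_triangular (Q := fun j => dualHahnPoly j b a)
    (degree_dualHahnPoly_sub_lt hb ha)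
    (p := fun P => IntegrableOn (fun t => dualHahnWeight a b t * P.eval (t ^ 2)) (Set.Ioi 0))
    (by simp) (fun P R hP hR => ?_) (fun c P hP => ?_) (P.natDegree + 1) (fun j _ => ?_) P ?_
  · simpa only [Polynomial.eval_add, mul_add] using! hP.add hR
  · simpa only [Polynomial.eval_mul, Polynomial.eval_C, mul_left_comm] using! hP.const_mul c
  · have := (integral_dualHahnWeight_mul_mixed (β := a - 1) (γ := b - 1) (by linarith)
      (by linarith) 0 j).1
    simpa only [sub_add_cancel, h0, one_mul] using this
  · exact Polynomial.degree_le_natDegree.trans_lt (by exact_mod_cast Nat.lt_succ_self _)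

/-- The polynomials of degree below `n` are spanned by the `dualHahnPoly j b a` with `j < n`, each
annihilated by the biorthogonality. -/
lemma integral_dualHahnWeight_mul_eq_zero {a b : ℝ} (ha : 0 < a) (hb : 0 < b) {n : ℕ}
    {P : Polynomial ℝ} (hP : P.degree < (n : WithBot ℕ)) :
    ∫ t in Set.Ioi (0 : ℝ), dualHahnWeight a b t * (dualHahnPoly n a b * P).eval (t ^ 2) = 0 := by
  refine polynomial_induction_of_triangular (Q := fun j => dualHahnPoly j b a)
    (degree_dualHahnPoly_sub_lt hb ha)
    (p := fun P => ∫ t in Set.Ioi (0 : ℝ),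
      dualHahnWeight a b t * (dualHahnPoly n a b * P).eval (t ^ 2) = 0)
    (by simp) (fun P R hP hR => ?_) (fun c P hP => ?_) n (fun j hj => ?_) P hP
  · simp_rw [mul_add, Polynomial.eval_add, mul_add]
    rw [integral_add (integrableOn_dualHahnWeight_mul_eval ha hb _)
      (integrableOn_dualHahnWeight_mul_eval ha hb _), hP, hR, add_zero]
  · simp_rw [mul_left_comm _ (Polynomial.C c), Polynomial.eval_mul (p := Polynomial.C c),
      Polynomial.eval_C, mul_left_comm _ c]
    rw [integral_const_mul, hP, mul_zero]
  · have := (integral_dualHahnWeight_mul_mixed (β := a - 1) (γ := b - 1) (by linarith)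
      (by linarith) n j).2
    simp only [sub_add_cancel, if_neg hj.ne', mul_zero, zero_mul] at this
    simpa only [Polynomial.eval_mul] using this

/-- Orthogonality of the continuous dual Hahn polynomials with third parameter `1/2`. -/
lemma integral_dualHahnWeight_mul_dualHahnPoly {β γ : ℝ} (hβ : -1 < β) (hγ : -1 < γ) (n m : ℕ) :
    ∫ t in Set.Ioi (0 : ℝ), dualHahnWeight (β + 1) (γ + 1) t *
      (dualHahnPoly n (β + 1) (γ + 1) * dualHahnPoly m (β + 1) (γ + 1)).eval (t ^ 2) =
      (n.factorial : ℝ) / 2 * (if n = m then 1 else 0) * Real.Gamma (n + β + γ + 2) *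
          Real.Gamma (n + β + 3 / 2) * Real.Gamma (n + γ + 3 / 2) := by
  have ha : 0 < β + 1 := by linarith
  have hb : 0 < γ + 1 := by linarith
  have hdeg : ∀ {n m : ℕ}, m < n → (dualHahnPoly m (β + 1) (γ + 1)).degree < (n : WithBot ℕ) := fun {n m} h => by
    have h1 := degree_dualHahnPoly_sub_lt ha hb m
    have h2 : (dualHahnPoly m (β + 1) (γ + 1) - Polynomial.C ((-1) ^ m) * Polynomial.X ^ m +
        Polynomial.C ((-1) ^ m) * Polynomial.X ^ m).degree < (n : WithBot ℕ) :=
      (Polynomial.degree_add_le _ _).trans_lt (max_lt (h1.trans (by exact_mod_cast h))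
        ((Polynomial.degree_C_mul_X_pow_le _ _).trans_lt (by exact_mod_cast h)))
    rwa [sub_add_cancel] at h2
  rcases lt_trichotomy m n with h | rfl | h
  · rw [integral_dualHahnWeight_mul_eq_zero ha hb (hdeg h), if_neg h.ne']
    ring
  · rw [← (integral_dualHahnWeight_mul_mixed hβ hγ m m).2, ← sub_eq_zero,
      ← integral_sub (integrableOn_dualHahnWeight_mul_eval ha hb _)
        (integral_dualHahnWeight_mul_mixed hβ hγ m m).1]
    -- The equal leading terms cancel, so exchanging the parameters in one factor changes the
    -- integrand only by a lower-degree multiple of `dualHahnPoly m`, whose integral vanishes.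
    have hd : (dualHahnPoly m (β + 1) (γ + 1) - dualHahnPoly m (γ + 1) (β + 1)).degree < (m : WithBot ℕ) := by
      have h1 := degree_dualHahnPoly_sub_lt ha hb m
      have h2 := degree_dualHahnPoly_sub_lt hb ha m
      have h3 := (Polynomial.degree_sub_le _ _).trans_lt (max_lt h1 h2)
      rwa [sub_sub_sub_cancel_right] at h3
    refine Eq.trans ?_ (integral_dualHahnWeight_mul_eq_zero ha hb hd)
    refine integral_congr_ae (Filter.Eventually.of_forall fun t => ?_)
    simp only [Polynomial.eval_mul, Polynomial.eval_sub]
    ring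
  · rw [mul_comm (dualHahnPoly n _ _), integral_dualHahnWeight_mul_eq_zero ha hb (hdeg h),
      if_neg h.ne]
    ring

theorem mainTheorem7 :
    -- the integrals defining `F_n(τ; α, β, μ, η)` converge absolutely
    (∀ α β μ η : ℝ, -1 < α → -1 < β → 0 ≤ μ → 0 < η → ∀ (n : ℕ) (τ : ℝ),
      IntegrableOn (klLaguerreIntegrand n τ α β μ η) (Set.Ioi 0)) ∧
    -- the orthogonality of the Kontorovich-Lebedev images
    (∀ α β γ μ : ℝ, -1 < β → -1 < γ → α = β + γ + 1 → 0 < μ → μ ≤ 1 → ∀ n m : ℕ,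
      IntegrableOn (fun τ : ℝ => τ * Real.sinh (Real.pi * τ) *
        klLaguerre n τ α β μ μ * klLaguerre m τ α γ (1 - μ) μ) (Set.Ioi 0) ∧
      ∫ τ in Set.Ioi (0 : ℝ), τ * Real.sinh (Real.pi * τ) *
          klLaguerre n τ α β μ μ * klLaguerre m τ α γ (1 - μ) μ =
        Real.pi ^ 2 / (2 * (n.factorial : ℝ)) * Real.Gamma (n + α + 1) *
          (if n = m then 1 else 0)) ∧
    -- the explicit form of `F_n(τ; α, β, μ, μ)`
    (∀ α β μ : ℝ, -1 < α → -1 < β → 0 < μ → ∀ n : ℕ,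
      (∀ τ : ℝ,
        (klLaguerre n τ α β μ μ : ℂ) =
          ((Real.sqrt Real.pi / (2 * μ) ^ (β + 1) : ℝ) : ℂ) *
            ∑ k ∈ Finset.range (n + 1),
              (-1 : ℂ) ^ k / (k.factorial : ℂ) *
                ((Ring.choose ((n : ℝ) + α) (n - k) : ℝ) : ℂ) * ((2 * μ : ℂ) ^ k)⁻¹ *
                (Complex.Gamma (β + k + 1 - Complex.I * τ) *
                  Complex.Gamma (β + k + 1 + Complex.I * τ) /
                  Complex.Gamma (β + k + 3 / 2)) ∧
        (klLaguerre n τ α β μ μ : ℂ) =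
          ((Real.sqrt Real.pi / ((2 * μ) ^ (β + 1) * (n.factorial : ℝ)) : ℝ) : ℂ) *
            (((‖Complex.Gamma (β + 1 - Complex.I * τ)‖ ^ 2 : ℝ) : ℂ) * poch (α + 1) n /
              Complex.Gamma (β + 3 / 2)) *
            hyp3F2 (-(n : ℂ)) (β + 1 + Complex.I * τ) (β + 1 - Complex.I * τ)
              (α + 1) (β + 3 / 2) (1 / (2 * μ))) ∧
      -- the hypergeometric factor is a (real) polynomial in `τ`
      (∃ p : Polynomial ℝ, ∀ τ : ℝ,
        hyp3F2 (-(n : ℂ)) (β + 1 + Complex.I * τ) (β + 1 - Complex.I * τ)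
          (α + 1) (β + 3 / 2) (1 / (2 * μ)) = ((p.eval τ : ℝ) : ℂ))) ∧
    -- the continuous dual Hahn orthogonality with third parameter `1/2`
    (∀ β γ : ℝ, -1 < β → -1 < γ → ∀ n m : ℕ,
      IntegrableOn (fun t : ℝ =>
        ((‖Complex.Gamma (β + 1 + Complex.I * t) * Complex.Gamma (γ + 1 + Complex.I * t) /
            Complex.Gamma (Complex.I * t)‖ ^ 2 : ℝ) : ℂ) *
          dualHahnS n t (β + 1) (γ + 1) (1 / 2) * dualHahnS m t (β + 1) (γ + 1) (1 / 2))
        (Set.Ioi 0) ∧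
      ∫ t in Set.Ioi (0 : ℝ),
        ((‖Complex.Gamma (β + 1 + Complex.I * t) * Complex.Gamma (γ + 1 + Complex.I * t) /
            Complex.Gamma (Complex.I * t)‖ ^ 2 : ℝ) : ℂ) *
          dualHahnS n t (β + 1) (γ + 1) (1 / 2) * dualHahnS m t (β + 1) (γ + 1) (1 / 2) =
        (((n.factorial : ℝ) / 2 * (if n = m then 1 else 0) * Real.Gamma (n + β + γ + 2) *
          Real.Gamma (n + β + 3 / 2) * Real.Gamma (n + γ + 3 / 2) : ℝ) : ℂ)) := by
  refine ⟨fun α β μ η _ hβ hμ hη n τ => (klLaguerre_integrableOn_and_eq hβ hμ hη n τ α).1,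
    fun α β γ μ hβ hγ hα hμ hμ1 n m => ?_, fun α β μ hα hβ hμ n =>
      ⟨fun τ => ⟨klLaguerre_self_complex hβ hμ n τ, klLaguerre_self_complex_hyp3F2 hα hβ hμ n τ⟩,
        exists_polynomial_hyp3F2_eq α β μ n⟩, fun β γ hβ hγ n m => ?_⟩
  · subst hα
    exact integral_klLaguerre_mul_klLaguerre hβ hγ hμ hμ1 n m
  · have heq : (fun t : ℝ =>
        ((‖Complex.Gamma (β + 1 + Complex.I * t) * Complex.Gamma (γ + 1 + Complex.I * t) /
            Complex.Gamma (Complex.I * t)‖ ^ 2 : ℝ) : ℂ) *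
          dualHahnS n t (β + 1) (γ + 1) (1 / 2) * dualHahnS m t (β + 1) (γ + 1) (1 / 2)) =
        fun t : ℝ => ((dualHahnWeight (β + 1) (γ + 1) t *
          (dualHahnPoly n (β + 1) (γ + 1) * dualHahnPoly m (β + 1) (γ + 1)).eval (t ^ 2) : ℝ) :
            ℂ) := by
      ext t
      have hw := norm_gamma_mul_gamma_div_gamma_sq (β + 1) (γ + 1) t
      rw [dualHahnS_eq_eval_dualHahnPoly, dualHahnS_eq_eval_dualHahnPoly, Polynomial.eval_mul]
      push_cast at hw
      rw [hw]
      push_cast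
      ring
    rw [heq]
    refine ⟨(integrableOn_dualHahnWeight_mul_eval (by linarith) (by linarith) _).ofReal, ?_⟩
    rw [integral_complex_ofReal, integral_dualHahnWeight_mul_dualHahnPoly hβ hγ]
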